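/- Conventions. Let $n\ge 1$, $t_1,\dots,t_{n-1},\alpha_n\in\mathbb C$, $t_n=1$; for $n=1$ put $t_0=-z$. Let $U\subset\mathbb C$ be open and connected. The Lenard operators $\mathcal L_k[u]$ are the unique differential polynomials in $u$ with $\mathcal L_0=\tfrac12$, $\partial_z\mathcal L_{k+1}=(\partial_z^3+4u\,\partial_z+2u_z)\mathcal L_k$ and $\mathcal L_k[0]=0$ for $k\ge1$. The $n$-th member of the second Painlevé hierarchy is $$\mathrm P_{II}^{(n)}:\quad \sum_{l=1}^{n}t_l\,(\partial_z+2w)\,\mathcal L_l[w'-w^2]=zw+\alpha_n .$$ The Hamiltonian. For $l\ge 1$ put $\mathcal M_j=(\partial_z+2w)\mathcal L_j[w'-w^2]$, $A^{(l)}_{2l+1}=4^l$, and $$A^{(l)}_{2k+1}=\tfrac{4^{k+1}}2\big(\mathcal L_{l-k}[w'-w^2]-\mathcal M_{l-k-1}'\big),\quad B^{(l)}_{2k+1}=\tfrac{4^{k+1}}2\mathcal M_{l-k-1}'\quad(0\le k<l),\qquad B^{(l)}_{2k}=-4^k\mathcal M_{l-k}\quad(1\le k\le l),$$ all other entries being $0$.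 Put $a_{2k+1}=\sum_{l=1}^n t_lA^{(l)}_{2k+1}-z\,\delta_{k,0}$, $b_{j}=\sum_{l=1}^n t_lB^{(l)}_{j}$ for $j\ge1$, $b_0=-\alpha_n$. The canonical coordinates are, for $k=1,\dots,n$, $P_k=(a_{2(n-k)+1}+b_{2(n-k)+1})/a_{2n+1}$ and $Q_k=\sum_{j=1}^n\frac1{2j}b_{2j}\,\partial S_{2j}/\partial\Pi_{2k}$, where $S_m$ is the $m$-th power sum of $2n$ quantities $q_j$, written as a polynomial in their elementary symmetric functions $\Pi_1,\dots,\Pi_{2n}$, and the derivative is taken at $\Pi_{2i}=P_i$, $\Pi_{2i-1}=0$. The Hamiltonian evaluated along $w$ is $$H^{(n)}=-\frac1{4^n}\Big(\sum_{l=0}^{n-1}a_{2l+1}a_{2(n-l)-1}-\sum_{l=0}^{n-1}b_{2l+1}b_{2(n-l)-1}+\sum_{l=0}^{n}b_{2l}b_{2(n-l)}\Big)+\frac{Q_n}{4^n},$$ and the sigma function of $w$ is the Hamiltonian along $w$, normalised by a constant that depends only on the $t_l$: $$\sigma_n=H^{(n)}+\tfrac14\sum_{l=1}^{n-2}t_l\,t_{n-1-l}$$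 (so $\sigma_n=H^{(n)}$ for $n\le2$). Modified Lenard operators. For $n>1$ let $\widehat{\mathcal L}_k=\widehat{\mathcal L}_k[\sigma_n'-\frac{t_{n-1}}2]$ be the unique differential polynomials in $\sigma_n'$ with $\widehat{\mathcal L}_0=\frac12$, $$\partial_z\widehat{\mathcal L}_{k+1}=\big(\partial_z^3+2(2\sigma_n'-t_{n-1})\partial_z+2\sigma_n''\big)\widehat{\mathcal L}_k ,$$ and constant term (value at $\sigma_n'=0$) $\left(-\frac{t_{n-1}}2\right)^k\frac12\binom{2k}{k}$ for $k\ge1$. For $n=1$ let $\widehat{\mathcal L}_k=\mathcal L_k[\sigma_1'+\frac z2]$. Put $f_n=\sum_{l=1}^nt_l\widehat{\mathcal L}_l$ and $f_1=\widehat{\mathcal L}_1$. Theorem. (a) Both families of differential polynomials exist and are unique. (b) For $n>1$, $\mathrm P_{II}^{(n)}$ is equivalent to $$(\mathrm{SF}_n)\quad -f_n'+(f_n')^2+(z-2f_n)\Big(\sum_{l=1}^nt_l\big(\widehat{\mathcal L}_l''-\widehat{\mathcal L}_{l+1}\big)+2f_1f_n+\sigma_n-\tfrac12t_{n-1}z\Big)=\alpha_n(\alpha_n-1)$$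 and for $n=1$, $\mathrm P_{II}^{(1)}$ is equivalent to $$(\mathrm{SF}_1)\quad -f_1'+(f_1')^2+(z-2f_1)\Big(\widehat{\mathcal L}_1''-\widehat{\mathcal L}_2+2f_1^2+\sigma_1+\tfrac{z^2}4\Big)=\alpha_1(\alpha_1-1),$$ in the following sense, for $n\ge 1$. (i) If $w$ is holomorphic on $U$ and solves $\mathrm P_{II}^{(n)}$, then its sigma function $\sigma_n$ is holomorphic on $U$, $\sigma_n'-\frac{t_{n-1}}2=w'-w^2$, and $\sigma_n$ solves $(\mathrm{SF}_n)$. If $\alpha_n\ne\frac12$ (and $U\neq\emptyset$), then $z-2f_n\not\equiv0$. If $z-2f_n\not\equiv0$, then $f_n'\not\equiv\frac12$, and $w=\dfrac{f_n'-\alpha_n}{z-2f_n}$ wherever $z\ne2f_n$. (ii) Conversely, if $\sigma$ is holomorphic on $U$, solves $(\mathrm{SF}_n)$ and has $f_n'\not\equiv\frac12$, then $V=\{z\in U: z\ne2f_n(z)\}$ is open and dense in $U$, the function $w=\dfrac{f_n'-\alpha_n}{z-2f_n}$ is holomorphic on $V$ and solves $\mathrm P_{II}^{(n)}$ there, its sigma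 function is $\sigma$, and it is the only solution of $\mathrm P_{II}^{(n)}$ on $V$ whose sigma function is $\sigma$. (c) For $n=1$ and any holomorphic $\sigma_1$ on $U$, at every point of $U$, $(\mathrm{SF}_1)$ is equivalent to $$(\sigma_1'')^2-2\sigma_1\sigma_1'+2z(\sigma_1')^2+2(\sigma_1')^3=\left(\alpha_1-\tfrac12\right)^2,$$ that is, to Okamoto's sigma form $(h'')^2+4(h')^3+2h'(zh'-h)=\left(\tfrac12(\alpha+\tfrac12)\right)^2$ of $\mathrm P_{II}$ for $h=\sigma_1/2$ and $\alpha=\alpha_1-1$. Moreover, for every holomorphic $w$ on $U$, $H^{(1)}=2H_{II}(2p,\tfrac14q)+\tfrac12q$ with $p=-P_1$, $q=Q_1$, where $H_{II}(p,q)=\tfrac12p(p-2q^2-z)-(\alpha_1+\tfrac12)q$ is Okamoto's Hamiltonian. -/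

import Mathlib

noncomputable section

/-- Differential polynomials over `ℂ` in one unknown function `u`: the variable `X i` stands for the
`i`-th derivative of `u`. -/
abbrev DiffPoly : Type := MvPolynomial ℕ ℂ

/-- The total derivative `d/dz` on differential polynomials, `X i ↦ X (i + 1)`. -/
def totalD : Derivation ℂ DiffPoly DiffPoly :=
  MvPolynomial.mkDerivation ℂ (fun i : ℕ => (MvPolynomial.X (i + 1) : DiffPoly))

/-- The value at `z` of the differential polynomial `p` applied to the function `g`. -/
def DiffPoly.evalAt (p : DiffPoly) (g : ℂ → ℂ) (z : ℂ) : ℂ :=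
  MvPolynomial.eval (fun i : ℕ => iteratedDeriv i g z) p

/-- `L` is the sequence of Lenard operators `L_k[u]`:
`d/dz L_{k+1} = (d³/dz³ + 4 u d/dz + 2 u_z) L_k`, `L_0 = 1/2`, `L_k[0] = 0` for `k ≥ 1`. -/
structure IsLenard (L : ℕ → DiffPoly) : Prop where
  zero : L 0 = MvPolynomial.C (1 / 2)
  succ : ∀ k, totalD (L (k + 1)) = totalD (totalD (totalD (L k)))
    + 4 * MvPolynomial.X 0 * totalD (L k) + 2 * MvPolynomial.X 1 * L k
  boundary : ∀ k, 1 ≤ k → MvPolynomial.eval (fun _ => 0) (L k) = 0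

/-- `L` is the sequence of modified Lenard operators with constant parameter `τ`, written as
differential polynomials in `v = σ'` (so `X 0` is `σ'`, `X 1` is `σ''`, and so on):
`d/dz L_{k+1} = (d³/dz³ + 2 (2 v - τ) d/dz + 2 v_z) L_k`, `L_0 = 1/2`, and the constant term of `L_k`
(its value at `v = 0`) is `(-τ/2)^k (1/2) binom(2k, k)` for `k ≥ 1`. -/
structure IsModLenard (τ : ℂ) (L : ℕ → DiffPoly) : Prop where
  zero : L 0 = MvPolynomial.C (1 / 2)
  succ : ∀ k, totalD (L (k + 1)) = totalD (totalD (totalD (L k)))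
    + 2 * (2 * MvPolynomial.X 0 - MvPolynomial.C τ) * totalD (L k) + 2 * MvPolynomial.X 1 * L k
  boundary : ∀ k, 1 ≤ k →
    MvPolynomial.eval (fun _ => 0) (L k) = (-τ / 2) ^ k * (1 / 2) * ((2 * k).choose k : ℂ)

/-- `L_k[w' - w²]` as a function of `z`. -/
def lenardOf (L : ℕ → DiffPoly) (w : ℂ → ℂ) (k : ℕ) (z : ℂ) : ℂ :=
  (L k).evalAt (fun x => deriv w x - w x ^ 2) z

/-- `(d/dz + 2w) L_k[w' - w²]` as a function of `z`. -/
def lenardMiura (L : ℕ → DiffPoly) (w : ℂ → ℂ) (k : ℕ) (z : ℂ) : ℂ :=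
  deriv (lenardOf L w k) z + 2 * w z * lenardOf L w k z

/-- The `n`-th member of the second Painlevé hierarchy, at the point `z`. -/
def PIIEq (L : ℕ → DiffPoly) (n : ℕ) (t : ℕ → ℂ) (α : ℂ) (w : ℂ → ℂ) (z : ℂ) : Prop :=
  lenardMiura L w n z + ∑ l ∈ Finset.Icc 1 (n - 1), t l * lenardMiura L w l z = z * w z + α

/-! ### The Hamiltonian -/

/-- The entry `A_{2k+1}^{(l)}`. -/
def entryA (L : ℕ → DiffPoly) (w : ℂ → ℂ) (l k : ℕ) (z : ℂ) : ℂ :=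
  if k = l then 4 ^ l
  else if k < l then
    4 ^ (k + 1) / 2 * (lenardOf L w (l - k) z - deriv (lenardMiura L w (l - k - 1)) z)
  else 0

/-- The entry `B_{2k+1}^{(l)}`. -/
def entryBodd (L : ℕ → DiffPoly) (w : ℂ → ℂ) (l k : ℕ) (z : ℂ) : ℂ :=
  if k < l then 4 ^ (k + 1) / 2 * deriv (lenardMiura L w (l - k - 1)) z else 0

/-- The entry `B_{2k}^{(l)}`, `k ≥ 1`. -/
def entryBeven (L : ℕ → DiffPoly) (w : ℂ → ℂ) (l k : ℕ) (z : ℂ) : ℂ :=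
  if 1 ≤ k ∧ k ≤ l then -(4 ^ k * lenardMiura L w (l - k) z) else 0

/-- The coefficient `a_{2k+1}^{(n)}` of the isomonodromy matrix. -/
def coeffA (L : ℕ → DiffPoly) (n : ℕ) (t : ℕ → ℂ) (w : ℂ → ℂ) (k : ℕ) (z : ℂ) : ℂ :=
  (∑ l ∈ Finset.Icc 1 n, t l * entryA L w l k z) - if k = 0 then z else 0

/-- The coefficient `b_{2k+1}^{(n)}` of the isomonodromy matrix. -/
def coeffBodd (L : ℕ → DiffPoly) (n : ℕ) (t : ℕ → ℂ) (w : ℂ → ℂ) (k : ℕ) (z : ℂ) : ℂ :=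
  ∑ l ∈ Finset.Icc 1 n, t l * entryBodd L w l k z

/-- The coefficient `b_{2k}^{(n)}` of the isomonodromy matrix, with `b_0^{(n)} = -α`. -/
def coeffBeven (L : ℕ → DiffPoly) (n : ℕ) (t : ℕ → ℂ) (α : ℂ) (w : ℂ → ℂ) (k : ℕ) (z : ℂ) : ℂ :=
  if k = 0 then -α else ∑ l ∈ Finset.Icc 1 n, t l * entryBeven L w l k z

/-- The canonical coordinate `P_k`, `1 ≤ k ≤ n`. -/
def canonP (L : ℕ → DiffPoly) (n : ℕ) (t : ℕ → ℂ) (w : ℂ → ℂ) (k : ℕ) (z : ℂ) : ℂ :=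
  (coeffA L n t w (n - k) z + coeffBodd L n t w (n - k) z) / coeffA L n t w n z

/-- The power sum `S_m = ∑_{j=1}^{N} q_j^m` as a polynomial in the elementary symmetric functions
`Π_1, …, Π_N` of `q_1, …, q_N`; the variable `X i` is `Π_{i+1}`. -/
def powerSumInElem (N m : ℕ) : MvPolynomial (Fin N) ℂ :=
  (MvPolynomial.esymmAlgEquiv (Fin N) ℂ (Fintype.card_fin N)).symm
    ⟨MvPolynomial.psum (Fin N) ℂ m, MvPolynomial.psum_isSymmetric (Fin N) ℂ m⟩

/-- The elementary symmetric functions of the `2n` roots `q_j` of the even polynomial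
`∑_{k<n} (b_{2k+1} + a_{2k+1}) q^{2k} + a_{2n+1} q^{2n}`: `Π_{2k} = P_k`, and `Π_k = 0` for odd `k`
(index `i` is `Π_{i+1}`). -/
def elemValues (L : ℕ → DiffPoly) (n : ℕ) (t : ℕ → ℂ) (w : ℂ → ℂ) (z : ℂ) (i : Fin (2 * n)) : ℂ :=
  if Even (i.val + 1) then canonP L n t w ((i.val + 1) / 2) z else 0

/-- The canonical coordinate `Q_k = ∑_{j=1}^n (1/(2j)) b_{2j} ∂S_{2j}/∂Π_{2k}`, `1 ≤ k ≤ n`. -/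
def canonQ (L : ℕ → DiffPoly) (n : ℕ) (t : ℕ → ℂ) (α : ℂ) (w : ℂ → ℂ) (k : ℕ) (z : ℂ) : ℂ :=
  if h : 2 * k - 1 < 2 * n then
    ∑ j ∈ Finset.Icc 1 n, 1 / (2 * (j : ℂ)) * coeffBeven L n t α w j z *
      MvPolynomial.eval (elemValues L n t w z)
        (MvPolynomial.pderiv (⟨2 * k - 1, h⟩ : Fin (2 * n)) (powerSumInElem (2 * n) (2 * j)))
  else 0

/-- The Hamiltonian `H^{(n)}` evaluated along the function `w`. -/
def hamiltonian (L : ℕ → DiffPoly) (n : ℕ) (t : ℕ → ℂ) (α : ℂ) (w : ℂ → ℂ) (z : ℂ) : ℂ :=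
  -(1 / 4 ^ n) *
    ((∑ l ∈ Finset.range n, coeffA L n t w l z * coeffA L n t w (n - 1 - l) z)
      - (∑ l ∈ Finset.range n, coeffBodd L n t w l z * coeffBodd L n t w (n - 1 - l) z)
      + ∑ l ∈ Finset.range (n + 1), coeffBeven L n t α w l z * coeffBeven L n t α w (n - l) z)
    + canonQ L n t α w n z / 4 ^ n

/-- The sigma function attached to `w`: the Hamiltonian along `w`, normalised by the additive constant
`(1/4) ∑_{l=1}^{n-2} t_l t_{n-1-l}` (an empty sum if `n ≤ 2`). -/
def sigmaOf (L : ℕ → DiffPoly) (n : ℕ) (t : ℕ → ℂ) (α : ℂ) (w : ℂ → ℂ) (z : ℂ) : ℂ :=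
  hamiltonian L n t α w z + 1 / 4 * ∑ l ∈ Finset.Icc 1 (n - 2), t l * t (n - 1 - l)

/-! ### The sigma form -/

/-- The modified Lenard operators along `σ`, for constant `t_{n-1}` (that is, for `n ≥ 2`). -/
def modLenardOf (Lh : ℕ → DiffPoly) (σ : ℂ → ℂ) (k : ℕ) (z : ℂ) : ℂ :=
  (Lh k).evalAt (deriv σ) z

/-- For `n = 1`, where `t_0 = -z`: the standard Lenard operators applied to `σ' + z/2`. -/
def modLenardOne (L : ℕ → DiffPoly) (σ : ℂ → ℂ) (k : ℕ) (z : ℂ) : ℂ :=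
  (L k).evalAt (fun x => deriv σ x + x / 2) z

/-- `f_n = ∑_{l=1}^n t_l Λ_l`. -/
def fSum (n : ℕ) (t : ℕ → ℂ) (Λ : ℕ → ℂ → ℂ) (z : ℂ) : ℂ :=
  ∑ l ∈ Finset.Icc 1 n, t l * Λ l z

/-- The sigma form for `n ≥ 2`, at the point `z`, where `Λ_k` are the modified Lenard operators
along `σ` (and `f_1 = Λ_1`). -/
def SigmaEq (n : ℕ) (t : ℕ → ℂ) (α : ℂ) (Λ : ℕ → ℂ → ℂ) (σ : ℂ → ℂ) (z : ℂ) : Prop :=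
  -deriv (fSum n t Λ) z + deriv (fSum n t Λ) z ^ 2
    + (z - 2 * fSum n t Λ z) *
      ((∑ l ∈ Finset.Icc 1 n, t l * (iteratedDeriv 2 (Λ l) z - Λ (l + 1) z))
        + 2 * Λ 1 z * fSum n t Λ z + σ z - 1 / 2 * t (n - 1) * z)
    = α * (α - 1)

/-- The sigma form for `n = 1`, at the point `z`; here `f_1 = Λ_1`. -/
def SigmaEqOne (α : ℂ) (Λ : ℕ → ℂ → ℂ) (σ : ℂ → ℂ) (z : ℂ) : Prop :=
  -deriv (Λ 1) z + deriv (Λ 1) z ^ 2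
    + (z - 2 * Λ 1 z) *
      ((iteratedDeriv 2 (Λ 1) z - Λ 2 z) + 2 * Λ 1 z ^ 2 + σ z + z ^ 2 / 4)
    = α * (α - 1)

/-- Equivalence on the domain `U` of an equation `P` for `w` and an equation `S` for `σ`,
through the transformation `w ↦ sig w` and its inverse `σ ↦ (f' - α) / (z - 2 f)`, `f = F σ`.
`τ` is the function `t_{n-1}` of `z`. The solutions of `P` with `z ≢ 2 f` correspond to the solutions
of `S` with `f' ≢ 1/2`. -/
structure SigmaEquivalence (U : Set ℂ) (α : ℂ) (τ : ℂ → ℂ) (P S : (ℂ → ℂ) → ℂ → Prop)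
    (sig F : (ℂ → ℂ) → ℂ → ℂ) : Prop where
  /-- The sigma function of a solution of `P` is a solution of `S`. -/
  forward : ∀ w : ℂ → ℂ, DifferentiableOn ℂ w U → (∀ z ∈ U, P w z) →
    DifferentiableOn ℂ (sig w) U ∧
    (∀ z ∈ U, deriv (sig w) z - τ z / 2 = deriv w z - w z ^ 2) ∧
    (∀ z ∈ U, S (sig w) z)
  /-- For `α ≠ 1/2` no solution of `P` has `z ≡ 2 f`. -/
  generic : ∀ w : ℂ → ℂ, DifferentiableOn ℂ w U → (∀ z ∈ U, P w z) → U.Nonempty → α ≠ 1 / 2 →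
    ∃ z ∈ U, z ≠ 2 * F (sig w) z
  /-- A solution of `P` with `z ≢ 2 f` is recovered from its sigma function, which has `f' ≢ 1/2`. -/
  recover : ∀ w : ℂ → ℂ, DifferentiableOn ℂ w U → (∀ z ∈ U, P w z) →
    (∃ z ∈ U, z ≠ 2 * F (sig w) z) →
    (∃ z ∈ U, deriv (F (sig w)) z ≠ 1 / 2) ∧
    ∀ z ∈ U, z ≠ 2 * F (sig w) z →
      w z = (deriv (F (sig w)) z - α) / (z - 2 * F (sig w) z)
  /-- A solution of `S` with `f' ≢ 1/2` is the sigma function of exactly one solution of `P`, which is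
  holomorphic on the open dense subset `z ≠ 2 f` of `U`. -/
  backward : ∀ σ : ℂ → ℂ, DifferentiableOn ℂ σ U → (∀ z ∈ U, S σ z) →
    (∃ z ∈ U, deriv (F σ) z ≠ 1 / 2) →
    ∃ V : Set ℂ, V = {z ∈ U | z ≠ 2 * F σ z} ∧ IsOpen V ∧ U ⊆ closure V ∧
    ∃ w : ℂ → ℂ, (∀ z ∈ V, w z = (deriv (F σ) z - α) / (z - 2 * F σ z)) ∧
      DifferentiableOn ℂ w V ∧ (∀ z ∈ V, P w z) ∧ (∀ z ∈ V, sig w z = σ z) ∧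
      ∀ w₁ : ℂ → ℂ, DifferentiableOn ℂ w₁ V → (∀ z ∈ V, P w₁ z) → (∀ z ∈ V, sig w₁ z = σ z) →
        ∀ z ∈ V, w₁ z = w z

/-! ### Okamoto's Hamiltonian and sigma form of the second Painlevé equation -/

/-- Okamoto's Hamiltonian `H_II(p, q) = p (p - 2 q² - z) / 2 - (α + 1/2) q`. -/
def okamotoHam (α p q z : ℂ) : ℂ :=
  1 / 2 * p * (p - 2 * q ^ 2 - z) - (α + 1 / 2) * q

/-- Okamoto's sigma form of the second Painlevé equation with parameter `α`:
`(h'')² + 4 (h')³ + 2 h' (z h' - h) = ((α + 1/2) / 2)²`. -/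
def OkamotoSigmaEq (α : ℂ) (h : ℂ → ℂ) (z : ℂ) : Prop :=
  iteratedDeriv 2 h z ^ 2 + 4 * deriv h z ^ 3 + 2 * deriv h z * (z * deriv h z - h z)
    = ((α + 1 / 2) / 2) ^ 2

end

/-!
Everything is reduced to the quadratic first integral of the Lenard recursion. With
`𝓛 = ∑ L_k X^k` the recursion is `𝓛' = X (𝓛''' + 4 u 𝓛' + 2 u' 𝓛)`, which is the derivative of
`𝓛² = 1/4 + X (2 𝓛 𝓛'' - 𝓛'² + 4 u 𝓛²)` divided by `2 𝓛`. The quadratic relation can be solved for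
`L_{k+1}`, which gives existence (`DiffPoly.isLenard_lenard`); uniqueness holds because the kernel of
the total derivative consists of the constants (`DiffPoly.eq_C_of_totalD_eq_zero`). The modified
operators are the Lenard operators after the substitution `u = v - τ / 2`
(`DiffPoly.isModLenard_iff`); their constant terms come from the value of the quadratic relation at
constants. The same description, with `τ = -z`, applies to `n = 1`, so that all `n` are treated at
once with `u = σ' - t_{n-1} / 2`.

Put `f = ∑ t_l L_l[u]` with `u = w' - w²`. The Painlevé equation reads `f' + 2 w f = z w + α`, that
is `w (z - 2 f) = f' - α` (`DiffPoly.pIIEq_iff`). The sums in the Hamiltonian are coefficients of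
`(T 𝓛)²`, `(T 𝓛)(T 𝓡')` and `(T 𝓡)²`, where `𝓡 = 𝓛' + 2 w 𝓛` and `T` collects the times, completed by
`t_0 = -z`; the quadratic relation `X (𝓡² - 2 𝓛 𝓡') + 𝓛² = 1/4` then gives
`σ = -w (f' + α - 1) - ∑ t_l (L_l'' - L_{l+1}) - 2 u f + t_{n-1} z / 2` on solutions
(`DiffPoly.sigmaOf_eq`; the last term is `-z² / 4` if `n = 1`). Newton's identities enter through
`Q_n = 4^n w` (`canonQ_last`).

Multiplied by `z - 2 f`, the formula for `σ` is the sigma form. Differentiated, it gives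
`σ' - t_{n-1} / 2 = w' - w²`, by the linear recursion (`DiffPoly.hasDerivAt_sigmaExpr`). If conversely
`σ` solves the sigma form and `w` is defined by `w (z - 2 f) = f' - α`, with
`f` built on `v = σ' - t_{n-1} / 2`, then the same formula for `σ` holds, and its derivative says
`(1 - 2 f') (v - (w' - w²)) = 0`. As `f' ≢ 1/2`, the identity theorem gives `v = w' - w²`, and `w`
solves the Painlevé equation (`DiffPoly.sigmaEquivalence`).
-/

namespace DiffPoly

/-! ### The total derivative -/

theorem totalD_C (a : ℂ) : totalD (MvPolynomial.C a) = 0 :=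
  totalD.map_algebraMap a

theorem totalD_X (i : ℕ) : totalD (MvPolynomial.X i) = MvPolynomial.X (i + 1) :=
  MvPolynomial.mkDerivation_X ℂ _ i

theorem pderiv_succ_totalD (i : ℕ) (p : DiffPoly) :
    MvPolynomial.pderiv (i + 1) (totalD p)
      = totalD (MvPolynomial.pderiv (i + 1) p) + MvPolynomial.pderiv i p := by
  have h : ⁅(MvPolynomial.pderiv (i + 1) : Derivation ℂ DiffPoly DiffPoly), totalD⁆
      = MvPolynomial.pderiv i := by
    refine MvPolynomial.derivation_ext fun j => ?_
    rw [Derivation.commutator_apply, totalD_X, MvPolynomial.pderiv_X, MvPolynomial.pderiv_X,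
      MvPolynomial.pderiv_X]
    by_cases hj : j = i + 1
    · subst hj
      simp
    · by_cases hj' : j = i
      · subst hj'
        simp
      · simp [hj, hj']
  have h' := DFunLike.congr_fun h p
  rw [Derivation.commutator_apply] at h'
  linear_combination h'

/-- The kernel of the total derivative consists of the constants: if `D p = 0`, the commutation
relation `[∂_{i+1}, D] = ∂_i` kills the partial derivatives of `p` from the highest one downwards. -/
theorem eq_C_of_totalD_eq_zero {p : DiffPoly} (h : totalD p = 0) :
    p = MvPolynomial.C (MvPolynomial.coeff 0 p) := by
  obtain ⟨N, hN⟩ : ∃ N, ∀ i, N ≤ i → MvPolynomial.pderiv i p = 0 := by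
    refine ⟨p.vars.sup id + 1, fun i hi => MvPolynomial.pderiv_eq_zero_of_notMem_vars fun hm => ?_⟩
    have : i ≤ p.vars.sup id := Finset.le_sup (f := id) hm
    omega
  have hdown : ∀ m i, N ≤ i + m → MvPolynomial.pderiv i p = 0 := by
    intro m
    induction m with
    | zero => intro i hi; exact hN i hi
    | succ m ih =>
      intro i hi
      have h1 := pderiv_succ_totalD i p
      rw [h, ih (i + 1) (by omega)] at h1
      simpa using h1.symm
  ext m
  rw [MvPolynomial.coeff_C]
  split_ifs with hm
  · rw [← hm]
  · obtain ⟨i, hi⟩ : ∃ i, m i ≠ 0 := by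
      by_contra! hc
      exact hm (Finsupp.ext fun i => by simp [hc i])
    have h1 := congrArg (MvPolynomial.coeff (m - Finsupp.single i 1)) (hdown N i (by omega))
    have hle : Finsupp.single i 1 ≤ m := by
      rw [Finsupp.single_le_iff]; omega
    rw [MvPolynomial.coeff_pderiv, tsub_add_cancel_of_le hle, MvPolynomial.coeff_zero] at h1
    rcases mul_eq_zero.mp h1 with h2 | h2
    · exact h2
    · exact absurd h2 (Nat.cast_add_one_ne_zero _)

theorem eq_of_totalD_eq_of_eval_eq {p q : DiffPoly} (hD : totalD p = totalD q)
    (h0 : MvPolynomial.eval (fun _ => 0) p = MvPolynomial.eval (fun _ => 0) q) : p = q := by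
  have h := eq_C_of_totalD_eq_zero (p := p - q) (by rw [map_sub, hD, sub_self])
  have h1 := congrArg (MvPolynomial.eval (fun _ => (0 : ℂ))) h
  rw [map_sub, h0, sub_self, MvPolynomial.eval_C] at h1
  rw [← h1, map_zero] at h
  exact sub_eq_zero.mp h

/-! ### Existence and uniqueness of the Lenard operators -/

/-- The Lenard operators, defined by the quadratic first integral of the linear recursion: with
`𝓛 = ∑ L_k X^k` it reads `𝓛² = 1/4 + X (2 𝓛 𝓛'' - 𝓛'² + 4 u 𝓛²)`, and since `L_0 = 1/2` its
coefficient of `X^(k+1)` can be solved for `L_{k+1}`. -/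
noncomputable def lenard : ℕ → DiffPoly
  | 0 => MvPolynomial.C (1 / 2)
  | k + 1 => (∑ i : Fin (k + 1), (2 * lenard i * totalD (totalD (lenard (k - i)))
      - totalD (lenard i) * totalD (lenard (k - i))
      + 4 * MvPolynomial.X 0 * (lenard i * lenard (k - i))))
      - ∑ i : Fin k, lenard (i + 1) * lenard (k - i)
  decreasing_by all_goals omega

/-- The derivation of the ring of power series over the differential polynomials that acts by the
total derivative on the coefficients. -/
noncomputable def coeffD (f : PowerSeries DiffPoly) : PowerSeries DiffPoly :=
  PowerSeries.mk fun k => totalD (PowerSeries.coeff k f)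

theorem coeffD_add (f g : PowerSeries DiffPoly) : coeffD (f + g) = coeffD f + coeffD g := by
  ext1 k; simp [coeffD]

theorem coeffD_sub (f g : PowerSeries DiffPoly) : coeffD (f - g) = coeffD f - coeffD g := by
  ext1 k; simp [coeffD]

theorem coeffD_mul (f g : PowerSeries DiffPoly) :
    coeffD (f * g) = f * coeffD g + coeffD f * g := by
  ext1 k
  simp only [coeffD, PowerSeries.coeff_mk, map_add, PowerSeries.coeff_mul, map_sum,
    Derivation.leibniz, smul_eq_mul, ← Finset.sum_add_distrib]
  refine Finset.sum_congr rfl fun _ _ => ?_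
  ring

theorem coeffD_C (p : DiffPoly) : coeffD (PowerSeries.C p) = PowerSeries.C (totalD p) := by
  ext1 k
  simp only [coeffD, PowerSeries.coeff_mk, PowerSeries.coeff_C]
  split_ifs <;> simp

theorem coeffD_X : coeffD PowerSeries.X = 0 := by
  ext1 k
  simp only [coeffD, PowerSeries.coeff_mk, PowerSeries.coeff_X]
  split_ifs <;> simp

theorem lenard_zero : lenard 0 = MvPolynomial.C (1 / 2) := by rw [lenard]

theorem lenard_succ (k : ℕ) : lenard (k + 1)
    = (∑ i : Fin (k + 1), (2 * lenard i * totalD (totalD (lenard (k - i)))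
      - totalD (lenard i) * totalD (lenard (k - i))
      + 4 * MvPolynomial.X 0 * (lenard i * lenard (k - i))))
      - ∑ i : Fin k, lenard (i + 1) * lenard (k - i) := by rw [lenard]

theorem coeff_mk_mul_mk {R : Type*} [Semiring R] (f g : ℕ → R) (k : ℕ) :
    PowerSeries.coeff k (PowerSeries.mk f * PowerSeries.mk g)
      = ∑ i ∈ Finset.range (k + 1), f i * g (k - i) := by
  rw [PowerSeries.coeff_mul, Finset.Nat.sum_antidiagonal_eq_sum_range_succ_mk]
  simp

theorem two_mul_C_half : (2 : DiffPoly) * MvPolynomial.C (1 / 2) = 1 := by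
  rw [show (2 : DiffPoly) = MvPolynomial.C 2 from (map_ofNat MvPolynomial.C 2).symm, ← map_mul]
  norm_num

theorem quadratic_lenard (k : ℕ) :
    ∑ i ∈ Finset.range (k + 2), lenard i * lenard (k + 1 - i)
      = ∑ i ∈ Finset.range (k + 1), (2 * lenard i * totalD (totalD (lenard (k - i)))
      - totalD (lenard i) * totalD (lenard (k - i))
      + 4 * MvPolynomial.X 0 * (lenard i * lenard (k - i))) := by
  have h := lenard_succ k
  rw [Finset.sum_range (n := k + 1), Finset.sum_range_succ, Finset.sum_range_succ']
  simp only [Nat.sub_self, Nat.sub_zero, Nat.add_sub_add_right]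
  rw [Finset.sum_range, lenard_zero]
  linear_combination h + lenard (k + 1) * two_mul_C_half

theorem quadratic_series_lenard :
    PowerSeries.mk lenard ^ 2 = PowerSeries.C (MvPolynomial.C (1 / 4))
      + PowerSeries.X * (2 * PowerSeries.mk lenard * coeffD (coeffD (PowerSeries.mk lenard))
        - coeffD (PowerSeries.mk lenard) ^ 2
        + 4 * PowerSeries.C (MvPolynomial.X 0) * PowerSeries.mk lenard ^ 2) := by
  ext1 k
  cases k with
  | zero =>
    simp only [pow_two, coeff_mk_mul_mk, map_add, PowerSeries.coeff_zero_X_mul]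
    rw [Finset.sum_range_one, lenard_zero, PowerSeries.coeff_zero_C, add_zero, ← map_mul]
    norm_num
  | succ k =>
    simp only [pow_two, map_add, PowerSeries.coeff_succ_X_mul, PowerSeries.coeff_succ_C,
      coeff_mk_mul_mk, quadratic_lenard]
    rw [show (4 : PowerSeries DiffPoly) = PowerSeries.C 4 from (map_ofNat PowerSeries.C 4).symm,
      show (2 : PowerSeries DiffPoly) = PowerSeries.C 2 from (map_ofNat PowerSeries.C 2).symm,
      ← map_mul, mul_assoc (PowerSeries.C 2), map_sub, PowerSeries.coeff_C_mul,
      PowerSeries.coeff_C_mul]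
    simp only [coeffD, PowerSeries.coeff_mk, coeff_mk_mul_mk, zero_add, Finset.mul_sum,
      ← Finset.sum_sub_distrib, ← Finset.sum_add_distrib, mul_assoc]

/-- Differentiating the quadratic relation gives `2 𝓛` times the linear recursion. -/
theorem linear_series_lenard :
    coeffD (PowerSeries.mk lenard) = PowerSeries.X *
      (coeffD (coeffD (coeffD (PowerSeries.mk lenard)))
        + 4 * PowerSeries.C (MvPolynomial.X 0) * coeffD (PowerSeries.mk lenard)
        + 2 * PowerSeries.C (MvPolynomial.X 1) * PowerSeries.mk lenard) := by
  have h := congrArg coeffD quadratic_series_lenard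
  have h2 : coeffD 2 = 0 := by
    rw [show (2 : PowerSeries DiffPoly) = PowerSeries.C (MvPolynomial.C 2) by
      rw [map_ofNat, map_ofNat],
      coeffD_C, totalD_C, map_zero]
  have h4 : coeffD 4 = 0 := by
    rw [show (4 : PowerSeries DiffPoly) = PowerSeries.C (MvPolynomial.C 4) by
      rw [map_ofNat, map_ofNat],
      coeffD_C, totalD_C, map_zero]
  simp only [pow_two, coeffD_add, coeffD_sub, coeffD_mul, coeffD_X, coeffD_C, totalD_C, totalD_X,
    h2, h4, map_zero] at h
  set l := PowerSeries.mk lenard with hl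
  have hl0 : 2 * l ≠ 0 := by
    intro h0
    have := congrArg (PowerSeries.coeff 0) h0
    rw [show (2 : PowerSeries DiffPoly) = PowerSeries.C 2 from (map_ofNat PowerSeries.C 2).symm,
      PowerSeries.coeff_C_mul, hl, PowerSeries.coeff_mk, lenard_zero, two_mul_C_half] at this
    simp at this
  refine mul_left_cancel₀ hl0 ?_
  linear_combination h

/-- The value of `L_k` at a constant `u = c`: at constants the quadratic relation reads
`ℓ² (1 - 4 c X) = 1/4`, and its logarithmic derivative is the recursion of the central binomial
coefficients. -/
theorem eval_const_lenard (c : ℂ) (k : ℕ) :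
    MvPolynomial.eval (fun i => if i = 0 then c else 0) (lenard k)
      = c ^ k * (1 / 2) * (k.centralBinom : ℂ) := by
  set e : DiffPoly →+* ℂ := MvPolynomial.eval (fun i => if i = 0 then c else 0) with he
  have heD : ∀ p, e (totalD p) = 0 := by
    intro p
    induction p using MvPolynomial.induction_on with
    | C a => rw [totalD_C, map_zero]
    | add p q hp hq => rw [map_add, map_add, hp, hq, add_zero]
    | mul_X p i hp =>
      rw [Derivation.leibniz, totalD_X, smul_eq_mul, smul_eq_mul, map_add, map_mul, map_mul, hp]
      simp [he]
  have hq := congrArg (PowerSeries.map e) quadratic_series_lenard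
  have hz : ∀ f, PowerSeries.map e (coeffD f) = 0 := by
    intro f; ext1 k; simp [coeffD, heD]
  simp only [map_pow, map_add, map_mul, map_sub, hz, PowerSeries.map_X, PowerSeries.map_C,
    map_ofNat] at hq
  set l := PowerSeries.map e (PowerSeries.mk lenard) with hl
  have hlk : ∀ k, PowerSeries.coeff k l = e (lenard k) := by intro k; simp [hl]
  have hX : e (MvPolynomial.X 0) = c := by simp [he]
  have hC : e (MvPolynomial.C (1 / 4)) = 1 / 4 := by simp [he]
  rw [hX, hC] at hq
  have hl0 : 2 * l ≠ 0 := by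
    intro h0
    have := congrArg (PowerSeries.coeff 0) h0
    rw [show (2 : PowerSeries ℂ) = PowerSeries.C 2 from (map_ofNat PowerSeries.C 2).symm,
      PowerSeries.coeff_C_mul, hlk, lenard_zero] at this
    simp [he] at this
  have hd := congrArg (PowerSeries.derivative ℂ) hq
  have h4 : PowerSeries.derivative ℂ (4 : PowerSeries ℂ) = 0 := by
    rw [show (4 : PowerSeries ℂ) = PowerSeries.C 4 from (map_ofNat PowerSeries.C 4).symm]
    exact PowerSeries.derivative_C
  simp only [map_add, pow_two, Derivation.leibniz, smul_eq_mul, PowerSeries.derivative_C,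
    PowerSeries.derivative_X, h4, mul_zero, sub_zero, zero_add, add_zero] at hd
  have hlin : PowerSeries.derivative ℂ l
      = PowerSeries.C (4 * c) * (PowerSeries.X * PowerSeries.derivative ℂ l)
        + PowerSeries.C (2 * c) * l := by
    refine mul_left_cancel₀ hl0 ?_
    simp only [map_mul, map_ofNat]
    linear_combination hd
  induction k with
  | zero => rw [lenard_zero]; simp [he]
  | succ k ih =>
    have hk := congrArg (PowerSeries.coeff k) hlin
    have hXd : PowerSeries.coeff k (PowerSeries.X * PowerSeries.derivative ℂ l)
        = k * e (lenard k) := by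
      cases k with
      | zero => simp
      | succ k => rw [PowerSeries.coeff_succ_X_mul, PowerSeries.coeff_derivative, hlk]; push_cast; ring
    rw [map_add, PowerSeries.coeff_C_mul, PowerSeries.coeff_C_mul, PowerSeries.coeff_derivative,
      hXd, hlk, hlk] at hk
    have hb : ((k : ℂ) + 1) * ((k + 1).centralBinom : ℂ) = 2 * (2 * k + 1) * (k.centralBinom : ℂ) := by
      exact_mod_cast Nat.succ_mul_centralBinom_succ k
    have hk1 : (k : ℂ) + 1 ≠ 0 := by exact_mod_cast Nat.succ_ne_zero k
    refine mul_left_cancel₀ hk1 ?_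
    rw [ih] at hk
    linear_combination hk - c ^ (k + 1) * (1 / 2) * hb

theorem isLenard_lenard : IsLenard lenard where
  zero := lenard_zero
  succ k := by
    have h := congrArg (PowerSeries.coeff (k + 1)) linear_series_lenard
    rw [PowerSeries.coeff_succ_X_mul,
      show (4 : PowerSeries DiffPoly) = PowerSeries.C 4 from (map_ofNat PowerSeries.C 4).symm,
      show (2 : PowerSeries DiffPoly) = PowerSeries.C 2 from (map_ofNat PowerSeries.C 2).symm,
      ← map_mul, ← map_mul, map_add, map_add, PowerSeries.coeff_C_mul,
      PowerSeries.coeff_C_mul] at h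
    simpa [coeffD] using h
  boundary k hk := by
    have h := eval_const_lenard 0 k
    rw [zero_pow (by omega), zero_mul, zero_mul] at h
    simpa using h

theorem isLenard_iff {L : ℕ → DiffPoly} : IsLenard L ↔ L = lenard := by
  refine ⟨fun h => funext fun k => ?_, fun h => h ▸ isLenard_lenard⟩
  induction k with
  | zero => rw [h.zero, lenard_zero]
  | succ k ih =>
    refine eq_of_totalD_eq_of_eval_eq ?_ ?_
    · rw [h.succ, isLenard_lenard.succ, ih]
    · rw [h.boundary _ (by omega), isLenard_lenard.boundary _ (by omega)]

/-- The substitution `u = v - τ / 2` in differential polynomials. -/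
noncomputable def shift (τ : ℂ) : DiffPoly →ₐ[ℂ] DiffPoly :=
  MvPolynomial.aeval fun i => MvPolynomial.X i - if i = 0 then MvPolynomial.C (τ / 2) else 0

theorem shift_X (τ : ℂ) (i : ℕ) : shift τ (MvPolynomial.X i)
    = MvPolynomial.X i - if i = 0 then MvPolynomial.C (τ / 2) else 0 :=
  MvPolynomial.aeval_X _ i

theorem totalD_shift (τ : ℂ) (p : DiffPoly) : totalD (shift τ p) = shift τ (totalD p) := by
  induction p using MvPolynomial.induction_on with
  | C a =>
    rw [totalD_C, map_zero, shift, MvPolynomial.aeval_C]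
    exact totalD.map_algebraMap a
  | add p q hp hq => simp only [map_add, hp, hq]
  | mul_X p i hp =>
    have h : totalD (if i = 0 then MvPolynomial.C (τ / 2) else 0) = 0 := by
      split_ifs
      · exact totalD_C _
      · exact map_zero _
    simp only [map_mul, Derivation.leibniz, smul_eq_mul, map_add, hp, totalD_X, shift_X, map_sub, h]
    simp

theorem eval_shift (τ : ℂ) (x : ℕ → ℂ) (p : DiffPoly) : MvPolynomial.eval x (shift τ p)
    = MvPolynomial.eval (fun i => x i - if i = 0 then τ / 2 else 0) p := by
  induction p using MvPolynomial.induction_on with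
  | C a => simp [shift]
  | add p q hp hq => simp only [map_add, hp, hq]
  | mul_X p i hp =>
    rw [map_mul, map_mul, map_mul, hp, shift_X]
    by_cases hi : i = 0 <;> simp [hi]

theorem isModLenard_shift (τ : ℂ) : IsModLenard τ fun k => shift τ (lenard k) where
  zero := by simp [lenard_zero, shift]
  succ k := by
    have h2 : 2 * MvPolynomial.C (τ / 2) = (MvPolynomial.C τ : DiffPoly) := by
      rw [show (2 : DiffPoly) = MvPolynomial.C 2 from (map_ofNat MvPolynomial.C 2).symm, ← map_mul]
      congr 1; ring
    simp only [totalD_shift, isLenard_lenard.succ, map_add, map_mul, shift_X, map_ofNat]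
    simp only [if_true, one_ne_zero, if_false, sub_zero]
    linear_combination (-2) * shift τ (totalD (lenard k)) * h2
  boundary k _ := by
    have h := eval_const_lenard (-τ / 2) k
    rw [Nat.centralBinom_eq_two_mul_choose] at h
    rw [eval_shift, ← h]
    congr 2
    funext i
    by_cases hi : i = 0
    · simp [hi, neg_div]
    · simp [hi]

theorem isModLenard_iff {τ : ℂ} {L : ℕ → DiffPoly} :
    IsModLenard τ L ↔ L = fun k => shift τ (lenard k) := by
  refine ⟨fun h => funext fun k => ?_, fun h => h ▸ isModLenard_shift τ⟩
  have h' := isModLenard_shift τ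
  induction k with
  | zero => rw [h.zero, ← h'.zero]
  | succ k ih =>
    refine eq_of_totalD_eq_of_eval_eq ?_ ?_
    · rw [h.succ, h'.succ (k := k), ih]
    · rw [h.boundary _ (by omega), h'.boundary _ (by omega)]

theorem lenard_one : lenard 1 = MvPolynomial.X 0 := by
  refine eq_of_totalD_eq_of_eval_eq ?_ ?_
  · rw [isLenard_lenard.succ 0, lenard_zero, totalD_C, totalD_X]
    simp only [map_zero, mul_zero, zero_add]
    linear_combination MvPolynomial.X 1 * two_mul_C_half
  · rw [isLenard_lenard.boundary 1 le_rfl]; simp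

theorem lenard_two : lenard 2 = MvPolynomial.X 2 + 3 * MvPolynomial.X 0 ^ 2 := by
  refine eq_of_totalD_eq_of_eval_eq ?_ ?_
  · have h3 : totalD (3 : DiffPoly) = 0 := by
      rw [show (3 : DiffPoly) = MvPolynomial.C 3 from (map_ofNat MvPolynomial.C 3).symm, totalD_C]
    rw [isLenard_lenard.succ 1, lenard_one]
    simp only [totalD_X, map_add, pow_two, Derivation.leibniz, smul_eq_mul, h3]
    ring
  · rw [isLenard_lenard.boundary 2 (by norm_num)]; simp

end DiffPoly

/-! ### Newton's identities and the coordinate `Q_n` -/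

/-- The embedding of the polynomial ring in `Π_1, …, Π_N` as symmetric polynomials; under it
`powerSumInElem` becomes the power sum. -/
theorem exists_algHom_powerSumInElem (N : ℕ) : ∃ ψ : MvPolynomial (Fin N) ℂ →ₐ[ℂ] MvPolynomial (Fin N) ℂ,
    Function.Injective ψ ∧ (∀ i : Fin N, ψ (MvPolynomial.X i) = MvPolynomial.esymm (Fin N) ℂ (i + 1)) ∧
      ∀ m, ψ (powerSumInElem N m) = MvPolynomial.psum (Fin N) ℂ m := by
  have h : ∀ p, (MvPolynomial.esymmAlgEquiv (Fin N) ℂ (Fintype.card_fin N) p :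
      MvPolynomial (Fin N) ℂ)
        = MvPolynomial.aeval (fun i : Fin N => MvPolynomial.esymm (Fin N) ℂ (i + 1)) p := fun p => by
    rw [MvPolynomial.esymmAlgEquiv_apply, MvPolynomial.esymmAlgHom_apply]
  refine ⟨MvPolynomial.aeval fun i : Fin N => MvPolynomial.esymm (Fin N) ℂ (i + 1),
    fun p q hpq => ?_, fun i => MvPolynomial.aeval_X _ i, fun m => ?_⟩
  · rw [← h, ← h] at hpq
    exact (MvPolynomial.esymmAlgEquiv (Fin N) ℂ (Fintype.card_fin N)).injective (Subtype.ext hpq)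
  · rw [← h, powerSumInElem, AlgEquiv.apply_symm_apply]

theorem powerSumInElem_newton (N : ℕ) (q : ℕ → MvPolynomial (Fin N) ℂ)
    (hq : ∀ i : Fin N, q (i.val + 1) = MvPolynomial.X i) (k : ℕ) (hk : 1 ≤ k) (hkN : k ≤ N) :
    powerSumInElem N k = (-1) ^ (k + 1) * k * q k -
      ∑ a ∈ Finset.HasAntidiagonal.antidiagonal k with a.1 ∈ Set.Ioo 0 k,
        (-1) ^ a.1 * q a.1 * powerSumInElem N a.2 := by
  obtain ⟨ψ, hinj, hX, hS⟩ := exists_algHom_powerSumInElem N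
  have hX' : ∀ k, 1 ≤ k → k ≤ N → ψ (q k) = MvPolynomial.esymm (Fin N) ℂ k := by
    intro k hk hkN
    obtain ⟨k, rfl⟩ : ∃ l, k = l + 1 := ⟨k - 1, by omega⟩
    rw [hq ⟨k, by omega⟩, hX]
  apply hinj
  rw [hS, MvPolynomial.psum_eq_mul_esymm_sub_sum _ _ _ hk, map_sub, map_sum, map_mul, map_mul,
    map_pow, map_neg, map_one, map_natCast, hX' k hk hkN]
  congr 1
  refine Finset.sum_congr rfl fun a ha => ?_
  have h2 := (Finset.mem_filter.mp ha).2
  rw [map_mul, map_mul, map_pow, map_neg, map_one, hX' a.1 h2.1 (h2.2.le.trans hkN), hS]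

theorem pderiv_last_powerSumInElem {N : ℕ} (j : Fin N) (hj : j.val + 1 = N) (m : ℕ) (hm : 1 ≤ m)
    (hmN : m ≤ N) : MvPolynomial.pderiv j (powerSumInElem N m)
      = if m = N then (-1) ^ (N + 1) * (N : MvPolynomial (Fin N) ℂ) else 0 := by
  obtain ⟨q, hq⟩ : ∃ q : ℕ → MvPolynomial (Fin N) ℂ,
      ∀ i : Fin N, q (i.val + 1) = MvPolynomial.X i :=
    ⟨fun k => if h : k - 1 < N then MvPolynomial.X ⟨k - 1, h⟩ else 0, fun i => by simp⟩
  have hsign : ∀ k : ℕ, MvPolynomial.pderiv j ((-1 : MvPolynomial (Fin N) ℂ) ^ k) = 0 := by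
    intro k
    rw [show (-1 : MvPolynomial (Fin N) ℂ) ^ k = MvPolynomial.C ((-1) ^ k) by simp,
      MvPolynomial.pderiv_C]
  have hqd : ∀ k, 1 ≤ k → k ≤ N → MvPolynomial.pderiv j (q k) = if k = N then 1 else 0 := by
    intro k hk hkN
    obtain ⟨k, rfl⟩ : ∃ l, k = l + 1 := ⟨k - 1, by omega⟩
    rw [hq ⟨k, by omega⟩, MvPolynomial.pderiv_X, Pi.single_apply]
    refine if_congr ?_ rfl rfl
    rw [Fin.ext_iff]
    constructor <;> intro h <;> simp only at * <;> omega
  induction m using Nat.strong_induction_on with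
  | _ m ih =>
    have hsum : MvPolynomial.pderiv j (∑ a ∈ Finset.HasAntidiagonal.antidiagonal m with a.1 ∈ Set.Ioo 0 m,
        (-1) ^ a.1 * q a.1 * powerSumInElem N a.2) = 0 := by
      rw [map_sum]
      refine Finset.sum_eq_zero fun a ha => ?_
      have h1 := Finset.HasAntidiagonal.mem_antidiagonal.mp (Finset.mem_filter.mp ha).1
      have h2 := (Finset.mem_filter.mp ha).2
      have h3 := h2.1
      have h4 := h2.2
      rw [Derivation.leibniz, Derivation.leibniz, hsign, hqd a.1 h3 (by omega),
        ih a.2 (by omega) (by omega) (by omega), if_neg (by omega), if_neg (by omega)]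
      simp
    rw [powerSumInElem_newton N q hq m hm hmN, map_sub, hsum, sub_zero, Derivation.leibniz, Derivation.leibniz, hsign,
      Derivation.map_natCast, hqd m hm hmN]
    split_ifs with h
    · subst h; simp
    · simp

/-- The power sums `S_2, …, S_{2n-2}` do not involve `Π_{2n}` and `∂S_{2n}/∂Π_{2n} = -2n`, so
that `Q_n = -b_{2n} = 4^n w`. -/
theorem canonQ_last (L : ℕ → DiffPoly) (hL : L 0 = MvPolynomial.C (1 / 2)) (n : ℕ) (hn : 1 ≤ n)
    (t : ℕ → ℂ) (ht : t n = 1) (α : ℂ) (w : ℂ → ℂ) (z : ℂ) :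
    canonQ L n t α w n z = 4 ^ n * w z := by
  have hM : lenardMiura L w 0 z = w z := by
    have h : lenardOf L w 0 = fun _ => 1 / 2 := by
      funext x
      simp [lenardOf, DiffPoly.evalAt, hL]
    simp only [lenardMiura, h, deriv_const]
    ring
  have hb : coeffBeven L n t α w n z = -(4 ^ n * w z) := by
    rw [coeffBeven, if_neg (by omega), Finset.sum_eq_single n]
    · rw [ht, entryBeven, if_pos ⟨hn, le_rfl⟩, Nat.sub_self, hM, one_mul]
    · intro l hl hln
      have := Finset.mem_Icc.mp hl
      rw [entryBeven, if_neg (by omega), mul_zero]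
    · intro h
      exact absurd (Finset.mem_Icc.mpr ⟨hn, le_rfl⟩) h
  have hlt : 2 * n - 1 < 2 * n := by omega
  rw [canonQ, dif_pos hlt, Finset.sum_eq_single n]
  · rw [pderiv_last_powerSumInElem ⟨2 * n - 1, hlt⟩ (by simp only; omega) (2 * n) (by omega) le_rfl,
      if_pos rfl, hb]
    have hn0 : (n : ℂ) ≠ 0 := by exact_mod_cast (by omega : n ≠ 0)
    simp only [pow_succ, pow_mul, map_mul, map_pow, map_neg, map_one, map_natCast]
    push_cast
    field_simp
    norm_num
  · intro l hl hln
    have := Finset.mem_Icc.mp hl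
    rw [pderiv_last_powerSumInElem ⟨2 * n - 1, hlt⟩ (by simp only; omega) (2 * l) (by omega)
      (by omega), if_neg (by omega), map_zero, mul_zero]
  · intro h
    exact absurd (Finset.mem_Icc.mpr ⟨hn, le_rfl⟩) h

namespace DiffPoly

/-! ### Differential polynomials along holomorphic functions -/

theorem differentiableOn_iteratedDeriv {U : Set ℂ} (hU : IsOpen U) {g : ℂ → ℂ}
    (hg : DifferentiableOn ℂ g U) (i : ℕ) : DifferentiableOn ℂ (iteratedDeriv i g) U := by
  induction i with
  | zero => rwa [iteratedDeriv_zero]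
  | succ i ih => rw [iteratedDeriv_succ]; exact ih.deriv hU

theorem hasDerivAt_evalAt {U : Set ℂ} (hU : IsOpen U) {g : ℂ → ℂ} (hg : DifferentiableOn ℂ g U)
    (p : DiffPoly) {z : ℂ} (hz : z ∈ U) :
    HasDerivAt (p.evalAt g) ((totalD p).evalAt g z) z := by
  unfold DiffPoly.evalAt
  induction p using MvPolynomial.induction_on with
  | C a => simpa [totalD_C] using hasDerivAt_const z a
  | add p q hp hq =>
    simp only [map_add]
    exact hp.fun_add hq
  | mul_X p i hp =>
    have h := ((differentiableOn_iteratedDeriv hU hg i).differentiableAt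
      (hU.mem_nhds hz)).hasDerivAt
    rw [← iteratedDeriv_succ] at h
    simp only [map_mul, MvPolynomial.eval_X, Derivation.leibniz, smul_eq_mul, map_add, totalD_X]
    refine (hp.mul h).congr_deriv ?_
    ring

theorem evalAt_congr {U : Set ℂ} (hU : IsOpen U) {g h : ℂ → ℂ} (hgh : Set.EqOn g h U)
    (p : DiffPoly) {z : ℂ} (hz : z ∈ U) : p.evalAt g z = p.evalAt h z := by
  have : (fun i => iteratedDeriv i g z) = fun i => iteratedDeriv i h z :=
    funext fun i => hgh.iteratedDeriv_of_isOpen hU i hz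
  rw [DiffPoly.evalAt, DiffPoly.evalAt, this]

theorem evalAt_add (p q : DiffPoly) (g : ℂ → ℂ) (z : ℂ) :
    (p + q).evalAt g z = p.evalAt g z + q.evalAt g z := map_add _ p q

theorem evalAt_mul (p q : DiffPoly) (g : ℂ → ℂ) (z : ℂ) :
    (p * q).evalAt g z = p.evalAt g z * q.evalAt g z := map_mul _ p q

theorem evalAt_sum {ι : Type*} (s : Finset ι) (p : ι → DiffPoly) (g : ℂ → ℂ) (z : ℂ) :
    (∑ i ∈ s, p i).evalAt g z = ∑ i ∈ s, (p i).evalAt g z := map_sum _ p s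

theorem evalAt_C (a : ℂ) (g : ℂ → ℂ) (z : ℂ) :
    DiffPoly.evalAt (MvPolynomial.C a) g z = a := MvPolynomial.eval_C a

theorem evalAt_X (i : ℕ) (g : ℂ → ℂ) (z : ℂ) :
    DiffPoly.evalAt (MvPolynomial.X i) g z = iteratedDeriv i g z := MvPolynomial.eval_X i

theorem evalAt_two (g : ℂ → ℂ) (z : ℂ) : DiffPoly.evalAt 2 g z = 2 :=
  map_ofNat (MvPolynomial.eval fun i => iteratedDeriv i g z) 2

theorem evalAt_three (g : ℂ → ℂ) (z : ℂ) : DiffPoly.evalAt 3 g z = 3 :=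
  map_ofNat (MvPolynomial.eval fun i => iteratedDeriv i g z) 3

theorem evalAt_four (g : ℂ → ℂ) (z : ℂ) : DiffPoly.evalAt 4 g z = 4 :=
  map_ofNat (MvPolynomial.eval fun i => iteratedDeriv i g z) 4

theorem evalAt_shift (τ : ℂ) (p : DiffPoly) (g : ℂ → ℂ) (z : ℂ) :
    (shift τ p).evalAt g z = p.evalAt (fun x => g x - τ / 2) z := by
  rw [DiffPoly.evalAt, eval_shift, DiffPoly.evalAt]
  congr 2
  funext i
  cases i with
  | zero => simp
  | succ i =>
    have h : deriv (fun x => g x - τ / 2) = deriv g := by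
      funext x
      rw [deriv_sub_const]
    rw [iteratedDeriv_succ', iteratedDeriv_succ', h]
    simp

/-- The differential polynomial `f = ∑_{l=1}^n t_l L_l`. -/
noncomputable def flow (n : ℕ) (t : ℕ → ℂ) : DiffPoly :=
  ∑ l ∈ Finset.Icc 1 n, MvPolynomial.C (t l) * lenard l

/-- The differential polynomial `∑_{l=1}^n t_l L_{l+1}`, whose total derivative is the image of
`f` under the recursion operator. -/
noncomputable def flowSucc (n : ℕ) (t : ℕ → ℂ) : DiffPoly :=
  ∑ l ∈ Finset.Icc 1 n, MvPolynomial.C (t l) * lenard (l + 1)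

theorem totalD_C_mul (a : ℂ) (p : DiffPoly) :
    totalD (MvPolynomial.C a * p) = MvPolynomial.C a * totalD p := by
  rw [Derivation.leibniz, totalD_C, smul_zero, add_zero, smul_eq_mul]

theorem totalD_flowSucc (n : ℕ) (t : ℕ → ℂ) : totalD (flowSucc n t)
    = totalD (totalD (totalD (flow n t))) + 4 * MvPolynomial.X 0 * totalD (flow n t)
      + 2 * MvPolynomial.X 1 * flow n t := by
  simp only [flow, flowSucc, map_sum, totalD_C_mul, isLenard_lenard.succ, Finset.mul_sum,
    ← Finset.sum_add_distrib]
  refine Finset.sum_congr rfl fun _ _ => ?_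
  ring

theorem evalAt_flow (n : ℕ) (t : ℕ → ℂ) (g : ℂ → ℂ) (z : ℂ) :
    (flow n t).evalAt g z = ∑ l ∈ Finset.Icc 1 n, t l * (lenard l).evalAt g z := by
  simp only [flow, evalAt_sum, evalAt_mul, evalAt_C]

theorem evalAt_totalD_flow (n : ℕ) (t : ℕ → ℂ) (g : ℂ → ℂ) (z : ℂ) :
    (totalD (flow n t)).evalAt g z
      = ∑ l ∈ Finset.Icc 1 n, t l * (totalD (lenard l)).evalAt g z := by
  simp only [flow, map_sum, totalD_C_mul, evalAt_sum, evalAt_mul, evalAt_C]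

theorem evalAt_totalD_totalD_flow (n : ℕ) (t : ℕ → ℂ) (g : ℂ → ℂ) (z : ℂ) :
    (totalD (totalD (flow n t))).evalAt g z
      = ∑ l ∈ Finset.Icc 1 n, t l * (totalD (totalD (lenard l))).evalAt g z := by
  simp only [flow, map_sum, totalD_C_mul, evalAt_sum, evalAt_mul, evalAt_C]

theorem evalAt_flowSucc (n : ℕ) (t : ℕ → ℂ) (g : ℂ → ℂ) (z : ℂ) :
    (flowSucc n t).evalAt g z = ∑ l ∈ Finset.Icc 1 n, t l * (lenard (l + 1)).evalAt g z := by
  simp only [flowSucc, evalAt_sum, evalAt_mul, evalAt_C]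

/-! ### The Hamiltonian along a solution -/

/-- The times in reversed order, completed by `t_0 = -z`: entry `i` is `t_{n-i}`, and `0` for `i > n`. -/
def revTime (n : ℕ) (t : ℕ → ℂ) (z : ℂ) (i : ℕ) : ℂ :=
  if i < n then t (n - i) else if i = n then -z else 0

/-- The coefficients of the product of the reversed times with a series `∑ X_i λ^i`. -/
theorem sum_revTime_mul (n : ℕ) (t : ℕ → ℂ) (z : ℂ) (X : ℕ → ℂ) (k : ℕ) (hk : k ≤ n) :
    ∑ i ∈ Finset.range (n - k + 1), revTime n t z i * X (n - k - i)
      = (∑ l ∈ Finset.Icc 1 n, t l * if k ≤ l then X (l - k) else 0)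
        - if k = 0 then z * X 0 else 0 := by
  set T : ℕ → ℂ := fun l => if l = 0 then -z else t l with hT
  have h1 : ∑ i ∈ Finset.range (n - k + 1), revTime n t z i * X (n - k - i)
      = ∑ l ∈ Finset.range (n + 1), if k ≤ l then T l * X (l - k) else 0 := by
    rw [← Finset.sum_filter]
    refine Finset.sum_nbij' (fun i => n - i) (fun l => n - l) ?_ ?_ ?_ ?_ ?_
    · intro i hi; simp only [Finset.mem_range, Finset.mem_filter] at *; omega
    · intro i hi; simp only [Finset.mem_range, Finset.mem_filter] at *; omega
    · intro i hi; simp only [Finset.mem_range] at *; omega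
    · intro i hi; simp only [Finset.mem_range, Finset.mem_filter] at *; omega
    · intro i hi
      have hi' := Finset.mem_range.mp hi
      rw [show n - i - k = n - k - i by omega]
      congr 1
      simp only [revTime, hT]
      split_ifs <;> first | rfl | omega
  rw [h1, Finset.sum_range_succ', Finset.range_eq_Ico,
    Finset.sum_Ico_add' (fun l => if k ≤ l then T l * X (l - k) else 0) 0 n 1, zero_add,
    Finset.Ico_add_one_right_eq_Icc, sub_eq_add_neg]
  congr 1
  · refine Finset.sum_congr rfl fun l hl => ?_
    have hl' := Finset.mem_Icc.mp hl
    simp only [hT, if_neg (show l ≠ 0 by omega)]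
    split_ifs <;> simp
  · simp only [hT, Nat.le_zero]
    split_ifs <;> simp

theorem coeff_mk_revTime_mul (n : ℕ) (t : ℕ → ℂ) (z : ℂ) (X : ℕ → ℂ) (k : ℕ) (hk : k ≤ n) :
    PowerSeries.coeff (n - k) (PowerSeries.mk (revTime n t z) * PowerSeries.mk X)
      = (∑ l ∈ Finset.Icc 1 n, t l * if k ≤ l then X (l - k) else 0)
        - if k = 0 then z * X 0 else 0 := by
  rw [coeff_mk_mul_mk, sum_revTime_mul n t z X k hk]

/-- The first coefficient of `T 𝓛` that does not enter the Hamiltonian. -/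
theorem coeff_succ_mk_revTime_mul (n : ℕ) (t : ℕ → ℂ) (z : ℂ) (X : ℕ → ℂ) :
    PowerSeries.coeff (n + 1) (PowerSeries.mk (revTime n t z) * PowerSeries.mk X)
      = ∑ l ∈ Finset.Icc 1 n, t l * X (l + 1) - z * X 1 := by
  have h0 : revTime n t z (n + 1) = 0 := by
    rw [revTime, if_neg (by omega), if_neg (by omega)]
  rw [coeff_mk_mul_mk, Finset.sum_range_succ, h0, zero_mul, add_zero]
  have h := sum_revTime_mul n t z (fun i => X (i + 1)) 0 (Nat.zero_le n)
  simp only [Nat.sub_zero, Nat.zero_le, if_true, zero_add] at h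
  rw [← h]
  refine Finset.sum_congr rfl fun i hi => ?_
  rw [Nat.sub_add_comm (by have := Finset.mem_range.mp hi; omega)]

/-- `∑ T_l T_{n-1-l}` for the completed times `T_0 = -z`, `T_l = t_l`. -/
theorem coeff_revTime_sq (n : ℕ) (hn : 1 ≤ n) (t : ℕ → ℂ) (z : ℂ) :
    PowerSeries.coeff (n + 1)
        (PowerSeries.mk (revTime n t z) * PowerSeries.mk (revTime n t z))
      = ∑ l ∈ Finset.Icc 1 (n - 2), t l * t (n - 1 - l)
        - 4 * (if n = 1 then -z ^ 2 / 4 else t (n - 1) * z / 2) := by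
  have h0 : revTime n t z (n + 1) = 0 := by
    rw [revTime, if_neg (by omega), if_neg (by omega)]
  rw [coeff_mk_mul_mk, Finset.sum_range_succ, Finset.sum_range_succ', h0, zero_mul, add_zero,
    Nat.sub_zero, h0, mul_zero, add_zero]
  obtain ⟨m, rfl⟩ : ∃ m, n = m + 1 := ⟨n - 1, by omega⟩
  cases m with
  | zero => simp [revTime]; ring
  | succ m =>
    rw [if_neg (by omega), Finset.sum_range_succ, Finset.sum_range_succ']
    have h1 : revTime (m + 1 + 1) t z (m + 1 + 1) = -z := by simp [revTime]
    have h2 : revTime (m + 1 + 1) t z 1 = t (m + 1) := by simp [revTime]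
    simp only [zero_add, Nat.add_sub_cancel, Nat.add_sub_add_right, h1, h2,
      Nat.add_sub_cancel_left]
    have h3 : ∑ l ∈ Finset.range m, revTime (m + 1 + 1) t z (l + 1 + 1)
          * revTime (m + 1 + 1) t z (m + 1 - l)
        = ∑ l ∈ Finset.Icc 1 m, t l * t (m + 1 - l) := by
      rw [← Finset.Ico_add_one_right_eq_Icc, ← zero_add 1,
        ← Finset.sum_Ico_add' (fun l => t l * t (m + 1 - l)) 0 m 1, ← Finset.range_eq_Ico]
      refine Finset.sum_congr rfl fun l hl => ?_
      have hl' := Finset.mem_range.mp hl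
      rw [revTime, revTime, if_pos (by omega), if_pos (by omega), mul_comm]
      congr 2 <;> omega
    rw [h3, show m + 1 + 1 - 2 = m by omega]
    ring

/-- The quadratic relation in terms of `𝓡 = 𝓛' + 2 w 𝓛` for `u = w' - w²`, namely
`X (𝓡² - 2 𝓛 𝓡') + 𝓛² = 1/4`, multiplied by the square of a weight `T` that is constant in `z`. -/
theorem weighted_quadratic (T l l₁ l₂ : PowerSeries ℂ) (w w' : ℂ)
    (h : l ^ 2 = PowerSeries.C (1 / 4) + PowerSeries.X * (2 * l * l₂ - l₁ ^ 2
      + 4 * PowerSeries.C (w' - w ^ 2) * l ^ 2)) :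
    (T * l) * (T * l) = PowerSeries.C (1 / 4) * (T * T)
      - PowerSeries.X * ((T * (l₁ + 2 * PowerSeries.C w * l)) * (T * (l₁ + 2 * PowerSeries.C w * l))
        - 2 * ((T * l)
          * (T * (l₂ + 2 * PowerSeries.C w * l₁ + 2 * PowerSeries.C w' * l)))) := by
  rw [map_sub, map_pow] at h
  linear_combination T ^ 2 * h

theorem quadratic_series_evalAt (g : ℂ → ℂ) (z : ℂ) :
    PowerSeries.mk (fun k => (lenard k).evalAt g z) ^ 2 = PowerSeries.C (1 / 4) + PowerSeries.X *
      (2 * PowerSeries.mk (fun k => (lenard k).evalAt g z)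
          * PowerSeries.mk (fun k => (totalD (totalD (lenard k))).evalAt g z)
        - PowerSeries.mk (fun k => (totalD (lenard k)).evalAt g z) ^ 2
        + 4 * PowerSeries.C (g z) * PowerSeries.mk (fun k => (lenard k).evalAt g z) ^ 2) := by
  set e : DiffPoly →+* ℂ := MvPolynomial.eval (fun i => iteratedDeriv i g z) with he
  have h := congrArg (PowerSeries.map e) quadratic_series_lenard
  have h0 : PowerSeries.map e (PowerSeries.mk lenard)
      = PowerSeries.mk (fun k => (lenard k).evalAt g z) := by
    ext1 k; simp [he, DiffPoly.evalAt]
  have h1 : PowerSeries.map e (coeffD (PowerSeries.mk lenard))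
      = PowerSeries.mk (fun k => (totalD (lenard k)).evalAt g z) := by
    ext1 k; simp [he, DiffPoly.evalAt, coeffD]
  have h2 : PowerSeries.map e (coeffD (coeffD (PowerSeries.mk lenard)))
      = PowerSeries.mk (fun k => (totalD (totalD (lenard k))).evalAt g z) := by
    ext1 k; simp [he, DiffPoly.evalAt, coeffD]
  have hX : e (MvPolynomial.X 0) = g z := by simp [he]
  have hC : e (MvPolynomial.C (1 / 4)) = 1 / 4 := by simp [he]
  simpa only [map_pow, map_add, map_mul, map_sub, h0, h1, h2, PowerSeries.map_X, PowerSeries.map_C,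
    map_ofNat, hX, hC] using h

variable {U : Set ℂ} {w : ℂ → ℂ} {z : ℂ}

theorem differentiableOn_deriv_sub_sq (hU : IsOpen U) (hw : DifferentiableOn ℂ w U) :
    DifferentiableOn ℂ (fun x => deriv w x - w x ^ 2) U :=
  (hw.deriv hU).sub (hw.pow 2)

theorem lenardMiura_eq (hU : IsOpen U) (hw : DifferentiableOn ℂ w U) (hz : z ∈ U) (k : ℕ) :
    lenardMiura lenard w k z
      = (totalD (lenard k)).evalAt (fun x => deriv w x - w x ^ 2) z
        + 2 * w z * (lenard k).evalAt (fun x => deriv w x - w x ^ 2) z := by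
  have h := hasDerivAt_evalAt hU (differentiableOn_deriv_sub_sq hU hw) (lenard k) hz
  exact congrArg (· + 2 * w z * lenardOf lenard w k z) h.deriv

theorem deriv_lenardMiura (hU : IsOpen U) (hw : DifferentiableOn ℂ w U) (hz : z ∈ U) (k : ℕ) :
    deriv (lenardMiura lenard w k) z
      = (totalD (totalD (lenard k))).evalAt (fun x => deriv w x - w x ^ 2) z
        + 2 * w z * (totalD (lenard k)).evalAt (fun x => deriv w x - w x ^ 2) z
        + 2 * deriv w z * (lenard k).evalAt (fun x => deriv w x - w x ^ 2) z := by
  have hu := differentiableOn_deriv_sub_sq hU hw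
  have h1 := hasDerivAt_evalAt hU hu (totalD (lenard k)) hz
  have h0 := hasDerivAt_evalAt hU hu (lenard k) hz
  have hw' := (hw.differentiableAt (hU.mem_nhds hz)).hasDerivAt
  have he : lenardMiura lenard w k =ᶠ[nhds z] fun y =>
      (totalD (lenard k)).evalAt (fun x => deriv w x - w x ^ 2) y
        + 2 * w y * (lenard k).evalAt (fun x => deriv w x - w x ^ 2) y := by
    filter_upwards [hU.mem_nhds hz] with y hy using lenardMiura_eq hU hw hy k
  rw [he.deriv_eq]
  refine ((h1.fun_add ((hw'.const_mul 2).fun_mul h0)).congr_deriv ?_).deriv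
  ring

/-- The Painlevé equation as an equation for `f = ∑ t_l L_l[w' - w²]`: `f' + 2 w f = z w + α`. -/
theorem pIIEq_iff (hU : IsOpen U) (hw : DifferentiableOn ℂ w U) (hz : z ∈ U) {n : ℕ} (hn : 1 ≤ n)
    {t : ℕ → ℂ} (ht : t n = 1) (α : ℂ) : PIIEq lenard n t α w z ↔
      (totalD (flow n t)).evalAt (fun x => deriv w x - w x ^ 2) z
        + 2 * w z * (flow n t).evalAt (fun x => deriv w x - w x ^ 2) z = z * w z + α := by
  have h : lenardMiura lenard w n z + ∑ l ∈ Finset.Icc 1 (n - 1), t l * lenardMiura lenard w l z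
      = ∑ l ∈ Finset.Icc 1 n, t l * lenardMiura lenard w l z := by
    obtain ⟨m, rfl⟩ : ∃ m, n = m + 1 := ⟨n - 1, by omega⟩
    rw [Finset.sum_Icc_succ_top (by omega), ht, one_mul, Nat.add_sub_cancel, add_comm]
  rw [PIIEq, h, evalAt_flow, evalAt_totalD_flow, Finset.mul_sum, ← Finset.sum_add_distrib]
  refine iff_of_eq (congrArg (· = z * w z + α) (Finset.sum_congr rfl fun l _ => ?_))
  rw [lenardMiura_eq hU hw hz]
  ring

/-- The antiderivative of `t_{n-1} / 2` that enters the sigma form; for `n = 1`, where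
`t_0 = -z`, it is `-z² / 4`. -/
noncomputable def gauge (n : ℕ) (t : ℕ → ℂ) (z : ℂ) : ℂ :=
  if n = 1 then -z ^ 2 / 4 else t (n - 1) * z / 2

theorem coeffBodd_eq (w : ℂ → ℂ) (z : ℂ) (n : ℕ) (t : ℕ → ℂ) (k : ℕ) (hk : k < n) :
    coeffBodd lenard n t w k z = 4 ^ (k + 1) / 2 * PowerSeries.coeff (n - 1 - k)
      (PowerSeries.mk (revTime n t z)
        * PowerSeries.mk fun k => deriv (lenardMiura lenard w k) z) := by
  rw [Nat.sub_right_comm, Nat.sub_sub n k 1, coeff_mk_revTime_mul n t z _ (k + 1) hk, coeffBodd,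
    if_neg (by omega), sub_zero, Finset.mul_sum]
  refine Finset.sum_congr rfl fun l _ => ?_
  rw [entryBodd, Nat.sub_sub]
  by_cases h : k < l
  · rw [if_pos h, if_pos (by omega)]; ring
  · rw [if_neg h, if_neg (by omega)]; ring

/-- In `a_{2k+1} + b_{2k+1}` the derivative terms cancel; the entry `4^l` of `A` and the term `-z` fit
the pattern because `L_0 = 1/2`. -/
theorem coeffA_add_coeffBodd (w : ℂ → ℂ) (z : ℂ) (n : ℕ) (t : ℕ → ℂ) (k : ℕ) (hk : k < n) :
    coeffA lenard n t w k z + coeffBodd lenard n t w k z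
      = 4 ^ (k + 1) / 2 * PowerSeries.coeff (n - k) (PowerSeries.mk (revTime n t z)
        * PowerSeries.mk fun k => lenardOf lenard w k z) := by
  have h0 : lenardOf lenard w 0 z = 1 / 2 := by rw [lenardOf, lenard_zero, evalAt_C]
  rw [coeff_mk_revTime_mul n t z _ k hk.le, coeffA, coeffBodd, sub_add_eq_add_sub,
    ← Finset.sum_add_distrib, mul_sub, Finset.mul_sum]
  congr 1
  · refine Finset.sum_congr rfl fun l _ => ?_
    rw [entryA, entryBodd]
    rcases lt_trichotomy k l with h | h | h
    · rw [if_neg (by omega), if_pos h, if_pos h, if_pos h.le]; ring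
    · subst h
      rw [if_pos rfl, if_neg (by omega), if_pos le_rfl, Nat.sub_self, h0]; ring
    · rw [if_neg (by omega), if_neg (by omega), if_neg (by omega), if_neg (by omega)]; ring
  · split_ifs with h
    · rw [h, h0]; ring
    · ring

/-- The entry `b_0 = -α` fits the pattern of the other `b_{2k}` because of the Painlevé equation `hα`. -/
theorem coeffBeven_eq (w : ℂ → ℂ) (z : ℂ) (n : ℕ) (t : ℕ → ℂ) (α : ℂ)
    (hα : ∑ l ∈ Finset.Icc 1 n, t l * lenardMiura lenard w l z = z * lenardMiura lenard w 0 z + α)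
    (k : ℕ) (hk : k ≤ n) :
    coeffBeven lenard n t α w k z = -(4 ^ k * PowerSeries.coeff (n - k)
      (PowerSeries.mk (revTime n t z) * PowerSeries.mk fun k => lenardMiura lenard w k z)) := by
  rw [coeff_mk_revTime_mul n t z _ k hk, coeffBeven]
  by_cases h0 : k = 0
  · subst h0
    simp only [Nat.zero_le, if_true, Nat.sub_zero, hα, pow_zero]
    ring
  · rw [if_neg h0, if_neg h0, sub_zero, Finset.mul_sum, ← Finset.sum_neg_distrib]
    refine Finset.sum_congr rfl fun l _ => ?_
    rw [entryBeven]
    by_cases h : k ≤ l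
    · rw [if_pos ⟨by omega, h⟩, if_pos h]; ring
    · rw [if_neg (by omega), if_neg h]; ring

theorem coeff_mul_range {R : Type*} [Semiring R] (f g : PowerSeries R) (k : ℕ) :
    PowerSeries.coeff k (f * g)
      = ∑ i ∈ Finset.range (k + 1), PowerSeries.coeff i f * PowerSeries.coeff (k - i) g := by
  rw [PowerSeries.coeff_mul, Finset.Nat.sum_antidiagonal_eq_sum_range_succ_mk]

/-- The sigma function of a solution of the Painlevé equation: the sums in the Hamiltonian are
coefficients of `(T 𝓛)²`, `(T 𝓛)(T 𝓡')` and `(T 𝓡)²`, and the quadratic relation reduces them to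
terms linear in the times. -/
theorem sigmaOf_eq (hU : IsOpen U) (hw : DifferentiableOn ℂ w U) (hz : z ∈ U) {n : ℕ} (hn : 1 ≤ n)
    {t : ℕ → ℂ} (ht : t n = 1) {α : ℂ} (hP : PIIEq lenard n t α w z) :
    sigmaOf lenard n t α w z
      = -w z * ((totalD (flow n t)).evalAt (fun x => deriv w x - w x ^ 2) z + α - 1)
        - ((totalD (totalD (flow n t))).evalAt (fun x => deriv w x - w x ^ 2) z
          - (flowSucc n t).evalAt (fun x => deriv w x - w x ^ 2) z)
        - 2 * (deriv w z - w z ^ 2) * (flow n t).evalAt (fun x => deriv w x - w x ^ 2) z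
        + gauge n t z := by
  have hPf := (pIIEq_iff hU hw hz hn ht α).mp hP
  set u : ℂ → ℂ := fun x => deriv w x - w x ^ 2 with hu
  set T := PowerSeries.mk (revTime n t z) with hT
  set c : ℕ → ℂ := fun i => PowerSeries.coeff i (T * PowerSeries.mk fun k => lenardOf lenard w k z)
    with hc
  set r : ℕ → ℂ := fun i => PowerSeries.coeff i
    (T * PowerSeries.mk fun k => lenardMiura lenard w k z) with hr
  set d : ℕ → ℂ := fun i => PowerSeries.coeff i
    (T * PowerSeries.mk fun k => deriv (lenardMiura lenard w k) z) with hd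
  have hM0 : lenardMiura lenard w 0 z = w z := by
    rw [lenardMiura_eq hU hw hz, lenard_zero, totalD_C, evalAt_C]
    simp only [DiffPoly.evalAt, map_zero]
    ring
  have hM0' : deriv (lenardMiura lenard w 0) z = deriv w z := by
    rw [deriv_lenardMiura hU hw hz, lenard_zero, totalD_C, map_zero, evalAt_C]
    simp only [DiffPoly.evalAt, map_zero]
    ring
  have hα : ∑ l ∈ Finset.Icc 1 n, t l * lenardMiura lenard w l z
      = z * lenardMiura lenard w 0 z + α := by
    rw [hM0, ← hPf, evalAt_flow, evalAt_totalD_flow, Finset.mul_sum, ← Finset.sum_add_distrib]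
    refine Finset.sum_congr rfl fun l _ => ?_
    rw [lenardMiura_eq hU hw hz]
    ring
  have hquad : ∑ i ∈ Finset.range (n + 2), c i * c (n + 1 - i)
      = 1 / 4 * (∑ l ∈ Finset.Icc 1 (n - 2), t l * t (n - 1 - l) - 4 * gauge n t z)
        - (∑ i ∈ Finset.range (n + 1), r i * r (n - i)
          - 2 * ∑ i ∈ Finset.range (n + 1), c i * d (n - i)) := by
    have h := congrArg (PowerSeries.coeff (n + 1)) (weighted_quadratic T _ _ _ (w z) (deriv w z)
      (quadratic_series_evalAt u z))
    have hr' : (PowerSeries.mk fun k => (totalD (lenard k)).evalAt u z) + 2 * PowerSeries.C (w z)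
        * (PowerSeries.mk fun k => (lenard k).evalAt u z)
        = PowerSeries.mk fun k => lenardMiura lenard w k z := by
      ext1 k
      rw [show (2 : PowerSeries ℂ) = PowerSeries.C 2 from (map_ofNat PowerSeries.C 2).symm,
        ← map_mul, map_add, PowerSeries.coeff_C_mul]
      simp only [PowerSeries.coeff_mk, lenardMiura_eq hU hw hz, hu]
    have hd' : (PowerSeries.mk fun k => (totalD (totalD (lenard k))).evalAt u z)
        + 2 * PowerSeries.C (w z) * (PowerSeries.mk fun k => (totalD (lenard k)).evalAt u z)
        + 2 * PowerSeries.C (deriv w z) * (PowerSeries.mk fun k => (lenard k).evalAt u z)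
        = PowerSeries.mk fun k => deriv (lenardMiura lenard w k) z := by
      ext1 k
      rw [show (2 : PowerSeries ℂ) = PowerSeries.C 2 from (map_ofNat PowerSeries.C 2).symm,
        ← map_mul, ← map_mul, map_add, map_add, PowerSeries.coeff_C_mul, PowerSeries.coeff_C_mul]
      simp only [PowerSeries.coeff_mk, deriv_lenardMiura hU hw hz, hu]
    rw [hr', hd', map_sub, PowerSeries.coeff_C_mul, PowerSeries.coeff_succ_X_mul, map_sub,
      show (2 : PowerSeries ℂ) = PowerSeries.C 2 from (map_ofNat PowerSeries.C 2).symm,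
      PowerSeries.coeff_C_mul, coeff_revTime_sq n hn t z, coeff_mul_range, coeff_mul_range,
      coeff_mul_range] at h
    exact h
  have hc0 : c 0 = 1 / 2 := by
    simp only [hc, hT, coeff_mk_mul_mk, zero_add, Finset.sum_range_one, Nat.sub_zero, lenardOf,
      lenard_zero, evalAt_C, revTime, if_pos (show 0 < n from hn), ht, one_mul]
  have hcn : c (n + 1) = (flowSucc n t).evalAt u z - z * u z := by
    simp only [hc, hT]
    rw [coeff_succ_mk_revTime_mul, evalAt_flowSucc]
    simp only [lenardOf, lenard_one, evalAt_X, iteratedDeriv_zero, hu]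
  have hdn : d n = (totalD (totalD (flow n t))).evalAt u z
      + 2 * w z * (totalD (flow n t)).evalAt u z + 2 * deriv w z * (flow n t).evalAt u z
      - z * deriv w z := by
    have h := coeff_mk_revTime_mul n t z (fun k => deriv (lenardMiura lenard w k) z) 0
      (Nat.zero_le n)
    simp only [Nat.sub_zero, Nat.zero_le, if_true, hM0'] at h
    simp only [hd, hT]
    rw [h, evalAt_flow, evalAt_totalD_flow, evalAt_totalD_totalD_flow, Finset.mul_sum,
      Finset.mul_sum, ← Finset.sum_add_distrib, ← Finset.sum_add_distrib]
    congr 1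
    refine Finset.sum_congr rfl fun l _ => ?_
    rw [deriv_lenardMiura hU hw hz]
    ring
  have hodd : ∑ l ∈ Finset.range n, coeffA lenard n t w l z * coeffA lenard n t w (n - 1 - l) z
      - ∑ l ∈ Finset.range n, coeffBodd lenard n t w l z * coeffBodd lenard n t w (n - 1 - l) z
      = 4 ^ n * (∑ l ∈ Finset.range n, c (l + 1) * c (n - l)
        - 2 * ∑ l ∈ Finset.range n, c (n - l) * d l) := by
    have hS : ∀ k, k < n → coeffA lenard n t w k z = 4 ^ (k + 1) / 2 * (c (n - k) - d (n - 1 - k)) :=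
      fun k hk => by
        linear_combination coeffA_add_coeffBodd w z n t k hk - coeffBodd_eq w z n t k hk
    have hflip : ∑ l ∈ Finset.range n, c (l + 1) * d (n - 1 - l)
        = ∑ l ∈ Finset.range n, c (n - l) * d l := by
      rw [← Finset.sum_range_reflect]
      refine Finset.sum_congr rfl fun l hl => ?_
      have hl' := Finset.mem_range.mp hl
      rw [show n - 1 - l + 1 = n - l by omega, show n - 1 - (n - 1 - l) = l by omega]
    rw [two_mul]
    nth_rewrite 1 [← hflip]
    rw [← Finset.sum_add_distrib, ← Finset.sum_sub_distrib, ← Finset.sum_sub_distrib,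
      Finset.mul_sum]
    refine Finset.sum_congr rfl fun l hl => ?_
    have hl' := Finset.mem_range.mp hl
    have hp : (4 : ℂ) ^ (l + 1) * 4 ^ (n - 1 - l + 1) = 4 * 4 ^ n := by
      rw [← pow_add, ← pow_succ']
      congr 1
      omega
    rw [hS l hl', hS (n - 1 - l) (by omega), coeffBodd_eq w z n t l hl',
      coeffBodd_eq w z n t (n - 1 - l) (by omega), show n - (n - 1 - l) = l + 1 by omega,
      show n - 1 - (n - 1 - l) = l by omega]
    change _ * (_ * (c (l + 1) - d l)) - (_ * d (n - 1 - l)) * (_ * d l) = _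
    linear_combination 1 / 4 * (c (n - l) * c (l + 1) - d (n - 1 - l) * c (l + 1)
      - c (n - l) * d l) * hp
  have heven : ∑ l ∈ Finset.range (n + 1),
      coeffBeven lenard n t α w l z * coeffBeven lenard n t α w (n - l) z
      = 4 ^ n * ∑ l ∈ Finset.range (n + 1), r l * r (n - l) := by
    rw [Finset.mul_sum]
    refine Finset.sum_congr rfl fun l hl => ?_
    have hl' := Finset.mem_range.mp hl
    have hp : (4 : ℂ) ^ l * 4 ^ (n - l) = 4 ^ n := by
      rw [← pow_add]
      congr 1
      omega
    rw [coeffBeven_eq w z n t α hα l (by omega), coeffBeven_eq w z n t α hα (n - l) (by omega),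
      show n - (n - l) = l by omega]
    change -(_ * r (n - l)) * -(_ * r l) = _
    linear_combination r l * r (n - l) * hp
  rw [Finset.sum_range_succ, Finset.sum_range_succ', Nat.sub_self, Nat.sub_zero, hc0, hcn,
    Finset.sum_range_succ' (fun i => c i * d (n - i)), Nat.sub_zero, hc0, hdn] at hquad
  have hflip : ∑ l ∈ Finset.range n, c (l + 1) * d (n - (l + 1))
      = ∑ l ∈ Finset.range n, c (n - l) * d l := by
    rw [← Finset.sum_range_reflect]
    refine Finset.sum_congr rfl fun l hl => ?_
    have hl' := Finset.mem_range.mp hl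
    rw [show n - 1 - l + 1 = n - l by omega, show n - (n - l) = l by omega]
  have hsucc : ∑ l ∈ Finset.range n, c (l + 1) * c (n + 1 - (l + 1))
      = ∑ l ∈ Finset.range n, c (l + 1) * c (n - l) :=
    Finset.sum_congr rfl fun l _ => by rw [Nat.add_sub_add_right]
  rw [hflip, hsucc] at hquad
  have h4 : (1 / 4 ^ n : ℂ) * 4 ^ n = 1 := by
    rw [one_div, inv_mul_cancel₀ (pow_ne_zero _ (by norm_num))]
  have hu' : u z = deriv w z - w z ^ 2 := rfl
  rw [sigmaOf, hamiltonian, canonQ_last lenard lenard_zero n hn t ht, hodd, heven, ← mul_add,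
    mul_div_cancel_left₀ _ (pow_ne_zero _ (by norm_num))]
  rw [hu'] at hquad
  linear_combination hquad * (-1) - w z * hPf - h4 * (∑ l ∈ Finset.range n, c (l + 1) * c (n - l)
        - 2 * ∑ l ∈ Finset.range n, c (n - l) * d l + ∑ l ∈ Finset.range (n + 1), r l * r (n - l))

end DiffPoly

namespace DiffPoly

/-! ### The transformation between the two equations -/

theorem differentiableOn_evalAt {U : Set ℂ} (hU : IsOpen U) {g : ℂ → ℂ}
    (hg : DifferentiableOn ℂ g U) (p : DiffPoly) : DifferentiableOn ℂ (p.evalAt g) U :=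
  fun _ hz => (hasDerivAt_evalAt hU hg p hz).differentiableAt.differentiableWithinAt

theorem hasDerivAt_gauge {n : ℕ} {t : ℕ → ℂ} {τ : ℂ → ℂ}
    (hτ : ∀ z, τ z = if n = 1 then -z else t (n - 1)) (z : ℂ) :
    HasDerivAt (gauge n t) (τ z / 2) z := by
  unfold gauge
  rw [hτ]
  split_ifs
  · refine ((((hasDerivAt_id z).fun_pow 2).neg).div_const 4).congr_deriv ?_
    simp only [id]
    norm_num
    ring
  · refine (((hasDerivAt_id z).const_mul (t (n - 1))).div_const 2).congr_deriv ?_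
    ring

/-- The value which the sigma form forces on `σ` when `w` and `v` are related by
`f' + 2 w f = z w + α`, `f = ∑ t_l L_l[v]`. -/
noncomputable def sigmaExpr (n : ℕ) (t : ℕ → ℂ) (α : ℂ) (w v : ℂ → ℂ) (z : ℂ) : ℂ :=
  -w z * ((totalD (flow n t)).evalAt v z + α - 1)
    - ((totalD (totalD (flow n t))).evalAt v z - (flowSucc n t).evalAt v z)
    - 2 * v z * (flow n t).evalAt v z + gauge n t z

/-- Under `f' + 2 w f = z w + α` all derivatives of `f` of order at least two cancel in the
derivative of `sigmaExpr`. -/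
theorem hasDerivAt_sigmaExpr {U : Set ℂ} (hU : IsOpen U) {w v : ℂ → ℂ}
    (hw : DifferentiableOn ℂ w U) (hv : DifferentiableOn ℂ v U) {n : ℕ} {t : ℕ → ℂ} {α : ℂ}
    {τ : ℂ → ℂ} (hτ : ∀ z, τ z = if n = 1 then -z else t (n - 1))
    (h : ∀ z ∈ U, (totalD (flow n t)).evalAt v z + 2 * w z * (flow n t).evalAt v z = z * w z + α)
    {z : ℂ} (hz : z ∈ U) : HasDerivAt (sigmaExpr n t α w v)
      ((1 - 2 * (totalD (flow n t)).evalAt v z) * (deriv w z - w z ^ 2)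
        + 2 * v z * (totalD (flow n t)).evalAt v z + τ z / 2) z := by
  have hw' := (hw.differentiableAt (hU.mem_nhds hz)).hasDerivAt
  have hv' := (hv.differentiableAt (hU.mem_nhds hz)).hasDerivAt
  have h0 := hasDerivAt_evalAt hU hv (flow n t) hz
  have h1 := hasDerivAt_evalAt hU hv (totalD (flow n t)) hz
  have h2 := hasDerivAt_evalAt hU hv (totalD (totalD (flow n t))) hz
  have hs := hasDerivAt_evalAt hU hv (flowSucc n t) hz
  rw [totalD_flowSucc] at hs
  simp only [evalAt_add, evalAt_mul, evalAt_X, evalAt_two, evalAt_four, iteratedDeriv_zero,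
    iteratedDeriv_one] at hs
  have hE : (totalD (totalD (flow n t))).evalAt v z + (2 * deriv w z * (flow n t).evalAt v z
      + 2 * w z * (totalD (flow n t)).evalAt v z) = 1 * w z + z * deriv w z := by
    refine (h1.fun_add ((hw'.const_mul 2).fun_mul h0)).unique ?_
    refine (((hasDerivAt_id z).fun_mul hw').add_const α).congr_of_eventuallyEq ?_
    filter_upwards [hU.mem_nhds hz] with y hy using h y hy
  have hraw := ((((hw'.fun_neg).fun_mul ((h1.add_const α).sub_const 1)).fun_sub
    (h2.fun_sub hs)).fun_sub ((hv'.const_mul 2).fun_mul h0)).fun_add (hasDerivAt_gauge hτ z)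
  refine hraw.congr_deriv ?_
  linear_combination (-w z) * hE + deriv w z * h z hz

theorem eq_of_deriv_eq_zero {U : Set ℂ} (hUo : IsOpen U) (hUc : IsPreconnected U) {g : ℂ → ℂ}
    (hg : ∀ z ∈ U, HasDerivAt g 0 z) {x y : ℂ} (hx : x ∈ U) (hy : y ∈ U) : g x = g y :=
  hUo.is_const_of_deriv_eq_zero hUc
    (fun z hz => (hg z hz).differentiableAt.differentiableWithinAt) (fun z hz => (hg z hz).deriv)
    hx hy

/-- The zero set of a holomorphic function that is not identically zero on a connected open set has
dense complement. -/
theorem subset_closure_ne_zero {U : Set ℂ} (hUo : IsOpen U) (hUc : IsPreconnected U) {g : ℂ → ℂ}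
    (hg : DifferentiableOn ℂ g U) (hne : ∃ z ∈ U, g z ≠ 0) :
    U ⊆ closure {z ∈ U | g z ≠ 0} := by
  intro z hz
  by_contra hcl
  obtain ⟨y, hy, hgy⟩ := hne
  refine hgy ((hg.analyticOnNhd hUo).eqOn_zero_of_preconnected_of_eventuallyEq_zero hUc hz ?_ hy)
  filter_upwards [isClosed_closure.isOpen_compl.mem_nhds hcl, hUo.mem_nhds hz] with x hx hxU
  by_contra hgx
  exact hx (subset_closure ⟨hxU, hgx⟩)

/-- For a solution of the Painlevé equation the sigma function has `σ' = t_{n-1} / 2 + w' - w²`. -/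
theorem hasDerivAt_sigmaOf {U : Set ℂ} (hU : IsOpen U) {w : ℂ → ℂ} (hw : DifferentiableOn ℂ w U)
    {n : ℕ} (hn : 1 ≤ n) {t : ℕ → ℂ} (ht : t n = 1) {α : ℂ} {τ : ℂ → ℂ}
    (hτ : ∀ z, τ z = if n = 1 then -z else t (n - 1)) (hP : ∀ z ∈ U, PIIEq lenard n t α w z)
    {z : ℂ} (hz : z ∈ U) :
    HasDerivAt (sigmaOf lenard n t α w) (deriv w z - w z ^ 2 + τ z / 2) z := by
  have h := hasDerivAt_sigmaExpr hU hw (differentiableOn_deriv_sub_sq hU hw) hτ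
    (fun y hy => (pIIEq_iff hU hw hy hn ht α).mp (hP y hy)) hz
  refine (h.congr_of_eventuallyEq ?_).congr_deriv (by ring)
  filter_upwards [hU.mem_nhds hz] with y hy using sigmaOf_eq hU hw hy hn ht (hP y hy)

/-- The equivalence, uniformly in `n`: `τ` is `t_{n-1}`, the function `F σ` is `∑ t_l L_l[σ' - τ/2]`,
and `S σ` is the sigma form in terms of `v = σ' - τ/2`. -/
theorem sigmaEquivalence {U : Set ℂ} (hUo : IsOpen U) (hUc : IsPreconnected U) {n : ℕ}
    (hn : 1 ≤ n) {t : ℕ → ℂ} (ht : t n = 1) {α : ℂ} {τ : ℂ → ℂ} {S : (ℂ → ℂ) → ℂ → Prop}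
    {F : (ℂ → ℂ) → ℂ → ℂ} (hτ : ∀ z, τ z = if n = 1 then -z else t (n - 1))
    (hF : ∀ σ, F σ = (flow n t).evalAt fun x => deriv σ x - τ x / 2)
    (hS : ∀ σ, DifferentiableOn ℂ σ U → ∀ z ∈ U, (S σ z ↔
      -(totalD (flow n t)).evalAt (fun x => deriv σ x - τ x / 2) z
        + (totalD (flow n t)).evalAt (fun x => deriv σ x - τ x / 2) z ^ 2
        + (z - 2 * (flow n t).evalAt (fun x => deriv σ x - τ x / 2) z)
          * ((totalD (totalD (flow n t))).evalAt (fun x => deriv σ x - τ x / 2) z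
            - (flowSucc n t).evalAt (fun x => deriv σ x - τ x / 2) z
            + 2 * (deriv σ z - τ z / 2) * (flow n t).evalAt (fun x => deriv σ x - τ x / 2) z
            + σ z - gauge n t z) = α * (α - 1))) :
    SigmaEquivalence U α τ (PIIEq lenard n t α) S (sigmaOf lenard n t α) F := by
  have hτd : Differentiable ℂ τ := by
    rw [show τ = fun z => if n = 1 then -z else t (n - 1) from funext hτ]
    split_ifs
    · exact differentiable_id.neg
    · exact differentiable_const _
  have hv : ∀ σ, ∀ V : Set ℂ, IsOpen V → DifferentiableOn ℂ σ V →
      DifferentiableOn ℂ (fun x => deriv σ x - τ x / 2) V := fun σ V hVo hσ =>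
    (hσ.deriv hVo).sub (hτd.div_const 2).differentiableOn
  have hsol : ∀ V : Set ℂ, IsOpen V → ∀ w, DifferentiableOn ℂ w V →
      (∀ z ∈ V, PIIEq lenard n t α w z) →
      Set.EqOn (fun x => deriv (sigmaOf lenard n t α w) x - τ x / 2)
        (fun x => deriv w x - w x ^ 2) V := by
    intro V hVo w hw hP z hz
    have h := (hasDerivAt_sigmaOf hVo hw hn ht hτ hP hz).deriv
    simp only [h]
    ring
  have hdF : ∀ σ, DifferentiableOn ℂ σ U → ∀ z ∈ U,
      HasDerivAt (F σ) ((totalD (flow n t)).evalAt (fun x => deriv σ x - τ x / 2) z) z := by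
    intro σ hσ z hz
    rw [hF]
    exact hasDerivAt_evalAt hUo (hv σ U hUo hσ) _ hz
  have hsig : ∀ w, DifferentiableOn ℂ w U → (∀ z ∈ U, PIIEq lenard n t α w z) →
      DifferentiableOn ℂ (sigmaOf lenard n t α w) U := fun w hw hP z hz =>
    (hasDerivAt_sigmaOf hUo hw hn ht hτ hP hz).differentiableAt.differentiableWithinAt
  have hrel : ∀ w, DifferentiableOn ℂ w U → (∀ z ∈ U, PIIEq lenard n t α w z) → ∀ z ∈ U,
      deriv (F (sigmaOf lenard n t α w)) z + 2 * w z * F (sigmaOf lenard n t α w) z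
        = z * w z + α := by
    intro w hw hP z hz
    rw [(hdF _ (hsig w hw hP) z hz).deriv, hF, evalAt_congr hUo (hsol U hUo w hw hP) _ hz,
      evalAt_congr hUo (hsol U hUo w hw hP) _ hz]
    exact (pIIEq_iff hUo hw hz hn ht α).mp (hP z hz)
  have hderiv_half : ∀ G : ℂ → ℂ, (∀ z ∈ U, z = 2 * G z) → ∀ z ∈ U, DifferentiableAt ℂ G z →
      deriv G z = 1 / 2 := by
    intro G hG z hz hd
    have h1 : HasDerivAt (fun x => 2 * G x) 1 z := by
      refine (hasDerivAt_id z).congr_of_eventuallyEq ?_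
      filter_upwards [hUo.mem_nhds hz] with y hy using (hG y hy).symm
    have h2 := (hd.hasDerivAt.const_mul 2).unique h1
    linear_combination h2 / 2
  refine ⟨fun w hw hP => ⟨hsig w hw hP, fun z hz => hsol U hUo w hw hP hz, fun z hz => ?_⟩,
    fun w hw hP hne hα => ?_, fun w hw hP hgen => ⟨?_, ?_⟩, fun σ hσ hSσ hhalf => ?_⟩
  · -- the sigma form, with `w` eliminated by `w (z - 2 f) = f' - α`
    rw [hS _ (hsig w hw hP) z hz]
    have hvz : deriv (sigmaOf lenard n t α w) z - τ z / 2 = deriv w z - w z ^ 2 :=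
      hsol U hUo w hw hP hz
    simp only [fun p => evalAt_congr hUo (hsol U hUo w hw hP) p hz, hvz]
    rw [sigmaOf_eq hUo hw hz hn ht (hP z hz)]
    have h := (pIIEq_iff hUo hw hz hn ht α).mp (hP z hz)
    linear_combination ((totalD (flow n t)).evalAt (fun x => deriv w x - w x ^ 2) z + α - 1) * h
  · by_contra! hall
    obtain ⟨z, hz⟩ := hne
    have h1 := hrel w hw hP z hz
    rw [hderiv_half _ hall z hz (hdF _ (hsig w hw hP) z hz).differentiableAt] at h1
    exact hα (by linear_combination -w z * hall z hz - h1)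
  · -- if `f' = 1/2` then `z - 2 f` is a nonzero constant, so `w`, and with it `f`, is constant
    by_contra! hall
    obtain ⟨z₀, hz₀, hne⟩ := hgen
    have hd := hdF _ (hsig w hw hP)
    have hconst : ∀ z ∈ U, z - 2 * F (sigmaOf lenard n t α w) z
        = z₀ - 2 * F (sigmaOf lenard n t α w) z₀ := fun z hz =>
      eq_of_deriv_eq_zero hUo hUc (g := fun x => x - 2 * F (sigmaOf lenard n t α w) x)
        (fun y hy => by
          have h := (hasDerivAt_id y).fun_sub ((hd y hy).const_mul 2)
          rw [← (hd y hy).deriv, hall y hy] at h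
          exact h.congr_deriv (by norm_num)) hz hz₀
    have hne' : z₀ - 2 * F (sigmaOf lenard n t α w) z₀ ≠ 0 := sub_ne_zero.mpr hne
    have hwc : ∀ z ∈ U, w z = w z₀ := by
      intro z hz
      have h1 := hrel w hw hP z hz
      have h2 := hrel w hw hP z₀ hz₀
      rw [hall z hz] at h1
      rw [hall z₀ hz₀] at h2
      refine mul_right_cancel₀ hne' ?_
      linear_combination h2 - h1 - w z * hconst z hz
    have hwd : ∀ z ∈ U, deriv w z = 0 := by
      intro z hz
      have : w =ᶠ[nhds z] fun _ => w z₀ := by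
        filter_upwards [hUo.mem_nhds hz] with y hy using hwc y hy
      rw [this.deriv_eq, deriv_const]
    have hFd : HasDerivAt (F (sigmaOf lenard n t α w)) 0 z₀ := by
      refine (hasDerivAt_const z₀ ((flow n t).evalAt (fun _ => -w z₀ ^ 2) 0)).congr_of_eventuallyEq
        ?_
      filter_upwards [hUo.mem_nhds hz₀] with y hy
      have hcu : Set.EqOn (fun x => deriv (sigmaOf lenard n t α w) x - τ x / 2)
          (fun _ => -w z₀ ^ 2) U := by
        intro x hx
        rw [hsol U hUo w hw hP hx]
        simp only [hwd x hx, hwc x hx]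
        ring
      rw [hF, evalAt_congr hUo hcu _ hy, DiffPoly.evalAt, DiffPoly.evalAt]
      congr 2
      funext i
      rw [iteratedDeriv_const, iteratedDeriv_const]
    have := hall z₀ hz₀
    rw [hFd.deriv] at this
    norm_num at this
  · intro z hz hne
    rw [eq_div_iff (sub_ne_zero.mpr hne)]
    linear_combination -hrel w hw hP z hz
  · set v : ℂ → ℂ := fun x => deriv σ x - τ x / 2 with hv_def
    have hvU := hv σ U hUo hσ
    have hf := differentiableOn_evalAt hUo hvU (flow n t)
    have hf' := differentiableOn_evalAt hUo hvU (totalD (flow n t))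
    have hsubU : {z ∈ U | z ≠ 2 * F σ z} ⊆ U := fun z hz => hz.1
    have hdiff : DifferentiableOn ℂ (fun z => z - 2 * F σ z) U := by
      rw [hF]
      exact differentiableOn_id.sub (hf.const_mul 2)
    have hVeq : {z ∈ U | z ≠ 2 * F σ z} = {z ∈ U | z - 2 * F σ z ≠ 0} := by
      ext z
      simp only [Set.mem_ofPred_eq, sub_ne_zero]
    have hVo : IsOpen {z ∈ U | z ≠ 2 * F σ z} := by
      rw [hVeq]
      exact hdiff.continuousOn.isOpen_inter_preimage hUo isOpen_compl_singleton
    obtain ⟨z₁, hz₁, hz₁half⟩ := hhalf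
    have hdense : U ⊆ closure {z ∈ U | z ≠ 2 * F σ z} := by
      rw [hVeq]
      refine subset_closure_ne_zero hUo hUc hdiff ?_
      by_contra! hall
      exact hz₁half (hderiv_half _ (fun z hz => sub_eq_zero.mp (hall z hz)) z₁ hz₁
        (hdF σ hσ z₁ hz₁).differentiableAt)
    set V := {z ∈ U | z ≠ 2 * F σ z} with hV
    have hvV := hv σ V hVo (hσ.mono hsubU)
    set w : ℂ → ℂ := fun z => ((totalD (flow n t)).evalAt v z - α)
      / (z - 2 * (flow n t).evalAt v z) with hw_def
    have hneV : ∀ z ∈ V, z - 2 * (flow n t).evalAt v z ≠ 0 := by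
      intro z hz
      have h := hz.2
      rw [hF] at h
      exact sub_ne_zero.mpr h
    have hwV : DifferentiableOn ℂ w V := by
      refine DifferentiableOn.div ((hf'.mono hsubU).sub_const α) ?_ hneV
      exact differentiableOn_id.sub ((hf.mono hsubU).const_mul 2)
    have hrelV : ∀ z ∈ V, (totalD (flow n t)).evalAt v z + 2 * w z * (flow n t).evalAt v z
        = z * w z + α := by
      intro z hz
      have h : w z * (z - 2 * (flow n t).evalAt v z) = (totalD (flow n t)).evalAt v z - α :=
        div_mul_cancel₀ _ (hneV z hz)
      linear_combination -h
    have hσV : ∀ z ∈ V, σ z = sigmaExpr n t α w v z := by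
      intro z hz
      have h := (hS σ hσ z hz.1).mp (hSσ z hz.1)
      refine mul_left_cancel₀ (hneV z hz) ?_
      unfold sigmaExpr
      linear_combination h - ((totalD (flow n t)).evalAt v z + α - 1) * hrelV z hz
    -- differentiating `σ` gives `(1 - 2 f') (v - (w' - w²)) = 0`
    have hprod : ∀ z ∈ V, (1 - 2 * (totalD (flow n t)).evalAt v z)
        * (v z - (deriv w z - w z ^ 2)) = 0 := by
      intro z hz
      have h := hasDerivAt_sigmaExpr (v := v) hVo hwV hvV hτ hrelV hz
      have hloc : σ =ᶠ[nhds z] sigmaExpr n t α w v := by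
        filter_upwards [hVo.mem_nhds hz] with y hy using hσV y hy
      have h2 := (h.congr_of_eventuallyEq hloc).deriv
      have h3 : v z = deriv σ z - τ z / 2 := rfl
      linear_combination h2 + h3
    have hvw : Set.EqOn (fun x => deriv w x - w x ^ 2) v V := by
      intro z hz
      have hcl : z ∈ closure {y ∈ U | 1 - 2 * (totalD (flow n t)).evalAt v y ≠ 0} := by
        refine subset_closure_ne_zero hUo hUc ((hf'.const_mul 2).const_sub 1) ⟨z₁, hz₁, fun h => ?_⟩
          hz.1
        rw [(hdF σ hσ z₁ hz₁).deriv] at hz₁half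
        exact hz₁half (by linear_combination -h / 2)
      have hcont : ContinuousOn (fun y => v y - (deriv w y - w y ^ 2)) V :=
        (hvV.sub (differentiableOn_deriv_sub_sq hVo hwV)).continuousOn
      by_contra hne
      have hopen : IsOpen (V ∩ (fun y => v y - (deriv w y - w y ^ 2)) ⁻¹' {0}ᶜ) :=
        hcont.isOpen_inter_preimage hVo isOpen_compl_singleton
      obtain ⟨y, ⟨hyV, hy0⟩, hy⟩ := mem_closure_iff.mp hcl _ hopen
        ⟨hz, fun h => hne (sub_eq_zero.mp h).symm⟩
      rcases mul_eq_zero.mp (hprod y hyV) with h | h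
      · exact hy.2 h
      · exact hy0 h
    have hPV : ∀ z ∈ V, PIIEq lenard n t α w z := by
      intro z hz
      rw [pIIEq_iff hVo hwV hz hn ht α, evalAt_congr hVo hvw _ hz, evalAt_congr hVo hvw _ hz]
      exact hrelV z hz
    have hwF : ∀ z ∈ V, w z = (deriv (F σ) z - α) / (z - 2 * F σ z) := by
      intro z hz
      rw [(hdF σ hσ z hz.1).deriv, hF]
    refine ⟨V, hV, hVo, hdense, w, hwF, hwV, hPV, fun z hz => ?_, fun w₁ hw₁ hP₁ hs₁ z hz => ?_⟩
    · rw [sigmaOf_eq hVo hwV hz hn ht (hPV z hz), hσV z hz, sigmaExpr]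
      simp only [fun p => evalAt_congr hVo hvw p hz]
      rw [show deriv w z - w z ^ 2 = v z from hvw hz]
    · have hv₁ : Set.EqOn (fun x => deriv w₁ x - w₁ x ^ 2) v V := by
        intro x hx
        have h : sigmaOf lenard n t α w₁ =ᶠ[nhds x] σ := by
          filter_upwards [hVo.mem_nhds hx] with y hy using hs₁ y hy
        rw [← hsol V hVo w₁ hw₁ hP₁ hx]
        simp only [h.deriv_eq, hv_def]
      have h := (pIIEq_iff hVo hw₁ hz hn ht α).mp (hP₁ z hz)
      rw [evalAt_congr hVo hv₁ _ hz, evalAt_congr hVo hv₁ _ hz] at h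
      refine mul_right_cancel₀ (hneV z hz) ?_
      linear_combination hrelV z hz - h

theorem fSum_eq_flow {n : ℕ} {t : ℕ → ℂ} {Λ : ℕ → ℂ → ℂ} {v : ℂ → ℂ}
    (hΛ : ∀ k, Λ k = (lenard k).evalAt v) : fSum n t Λ = (flow n t).evalAt v := by
  funext z
  simp only [fSum, hΛ, evalAt_flow]

theorem iteratedDeriv_two_evalAt {U : Set ℂ} (hU : IsOpen U) {g : ℂ → ℂ}
    (hg : DifferentiableOn ℂ g U) (p : DiffPoly) {z : ℂ} (hz : z ∈ U) :
    iteratedDeriv 2 (p.evalAt g) z = (totalD (totalD p)).evalAt g z := by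
  have he : deriv (p.evalAt g) =ᶠ[nhds z] (totalD p).evalAt g := by
    filter_upwards [hU.mem_nhds hz] with y hy using (hasDerivAt_evalAt hU hg p hy).deriv
  rw [iteratedDeriv_succ, iteratedDeriv_one, he.deriv_eq]
  exact (hasDerivAt_evalAt hU hg _ hz).deriv

/-! ### The case `n = 1` -/

theorem flow_one {t : ℕ → ℂ} (ht : t 1 = 1) : flow 1 t = lenard 1 := by
  simp [flow, ht]

theorem flowSucc_one {t : ℕ → ℂ} (ht : t 1 = 1) : flowSucc 1 t = lenard 2 := by
  simp [flowSucc, ht]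

/-- For `n = 1` the sigma form reduces, since `L_1[u] = u`, `L_2[u] = u'' + 3 u²` and
`z - 2 u = -2 σ'`, to Okamoto's sigma form up to normalisation. -/
theorem sigmaEqOne_iff {U : Set ℂ} (hU : IsOpen U) {σ : ℂ → ℂ} (hσ : DifferentiableOn ℂ σ U)
    (α : ℂ) {z : ℂ} (hz : z ∈ U) : SigmaEqOne α (modLenardOne lenard σ) σ z ↔
      iteratedDeriv 2 σ z ^ 2 - 2 * σ z * deriv σ z + 2 * z * deriv σ z ^ 2
        + 2 * deriv σ z ^ 3 = (α - 1 / 2) ^ 2 := by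
  have hv : DifferentiableOn ℂ (fun x => deriv σ x + x / 2) U :=
    (hσ.deriv hU).add (differentiableOn_id.div_const 2)
  have hΛ : ∀ k, modLenardOne lenard σ k = (lenard k).evalAt (fun x => deriv σ x + x / 2) :=
    fun k => rfl
  have h1 : deriv (fun x => deriv σ x + x / 2) z = iteratedDeriv 2 σ z + 1 / 2 := by
    have h := ((hσ.deriv hU).differentiableAt (hU.mem_nhds hz)).hasDerivAt
    rw [iteratedDeriv_succ, iteratedDeriv_one]
    exact (h.fun_add ((hasDerivAt_id z).div_const 2)).deriv
  rw [SigmaEqOne, hΛ, hΛ, (hasDerivAt_evalAt hU hv (lenard 1) hz).deriv,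
    iteratedDeriv_two_evalAt hU hv _ hz, lenard_one, lenard_two, totalD_X, totalD_X]
  simp only [evalAt_add, evalAt_mul, pow_two, evalAt_X, evalAt_three, zero_add, iteratedDeriv_zero,
    iteratedDeriv_one, one_add_one_eq_two, h1]
  constructor <;> intro h <;> linear_combination h

theorem okamotoSigmaEq_iff (σ : ℂ → ℂ) (α z : ℂ) : OkamotoSigmaEq (α - 1) (fun x => σ x / 2) z ↔
      iteratedDeriv 2 σ z ^ 2 - 2 * σ z * deriv σ z + 2 * z * deriv σ z ^ 2
        + 2 * deriv σ z ^ 3 = (α - 1 / 2) ^ 2 := by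
  have h1 : deriv (fun x => σ x / 2) = fun x => deriv σ x / 2 := by
    funext x
    rw [deriv_div_const]
  have h2 : iteratedDeriv 2 (fun x => σ x / 2) z = iteratedDeriv 2 σ z / 2 := by
    rw [iteratedDeriv_succ, iteratedDeriv_one, h1, deriv_div_const, iteratedDeriv_succ,
      iteratedDeriv_one]
  rw [OkamotoSigmaEq, h1, h2]
  constructor <;> intro h
  · linear_combination 4 * h
  · linear_combination h / 4

theorem hamiltonian_one {U : Set ℂ} (hU : IsOpen U) {w : ℂ → ℂ} (hw : DifferentiableOn ℂ w U)
    {t : ℕ → ℂ} (ht : t 1 = 1) (α : ℂ) {z : ℂ} (hz : z ∈ U) :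
    hamiltonian lenard 1 t α w z
      = 2 * okamotoHam α (2 * -canonP lenard 1 t w 1 z) (canonQ lenard 1 t α w 1 z / 4) z
        + canonQ lenard 1 t α w 1 z / 2 := by
  have hu : lenardOf lenard w 1 z = deriv w z - w z ^ 2 := by
    rw [lenardOf, lenard_one, evalAt_X, iteratedDeriv_zero]
  have hM0 : lenardMiura lenard w 0 z = w z := by
    rw [lenardMiura_eq hU hw hz, lenard_zero, totalD_C, evalAt_C]
    simp only [DiffPoly.evalAt, map_zero]
    ring
  have hM0' : deriv (lenardMiura lenard w 0) z = deriv w z := by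
    rw [deriv_lenardMiura hU hw hz, lenard_zero, totalD_C, map_zero, evalAt_C]
    simp only [DiffPoly.evalAt, map_zero]
    ring
  rw [hamiltonian, okamotoHam, canonQ_last lenard lenard_zero 1 le_rfl t ht, canonP]
  simp [coeffA, coeffBodd, coeffBeven, entryA, entryBodd, entryBeven, ht, hu, hM0, hM0',
    Finset.sum_range_succ]
  ring

end DiffPoly

/-! ### The hierarchy and its sigma form -/

theorem theorem1p1 (n : ℕ) (hn : 1 ≤ n) (t : ℕ → ℂ) (ht : t n = 1) (α : ℂ)
    (U : Set ℂ) (hUo : IsOpen U) (hUc : IsPreconnected U) :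
    (∃! L : ℕ → DiffPoly, IsLenard L) ∧
    (∃! Lh : ℕ → DiffPoly, IsModLenard (t (n - 1)) Lh) ∧
    ∀ L : ℕ → DiffPoly, IsLenard L →
      (1 < n → ∀ Lh : ℕ → DiffPoly, IsModLenard (t (n - 1)) Lh →
        SigmaEquivalence U α (fun _ => t (n - 1)) (PIIEq L n t α)
          (fun σ z => SigmaEq n t α (modLenardOf Lh σ) σ z)
          (sigmaOf L n t α) (fun σ => fSum n t (modLenardOf Lh σ))) ∧
      (n = 1 →
        SigmaEquivalence U α (fun z => -z) (PIIEq L 1 t α)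
          (fun σ z => SigmaEqOne α (modLenardOne L σ) σ z)
          (sigmaOf L 1 t α) (fun σ => modLenardOne L σ 1) ∧
        (∀ σ : ℂ → ℂ, DifferentiableOn ℂ σ U → ∀ z ∈ U,
          (SigmaEqOne α (modLenardOne L σ) σ z ↔
            iteratedDeriv 2 σ z ^ 2 - 2 * σ z * deriv σ z + 2 * z * deriv σ z ^ 2
              + 2 * deriv σ z ^ 3 = (α - 1 / 2) ^ 2) ∧
          (SigmaEqOne α (modLenardOne L σ) σ z ↔ OkamotoSigmaEq (α - 1) (fun x => σ x / 2) z)) ∧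
        (∀ w : ℂ → ℂ, DifferentiableOn ℂ w U → ∀ z ∈ U,
          hamiltonian L 1 t α w z =
            2 * okamotoHam α (2 * -canonP L 1 t w 1 z) (canonQ L 1 t α w 1 z / 4) z
              + canonQ L 1 t α w 1 z / 2)) := by
  refine ⟨⟨_, DiffPoly.isLenard_lenard, fun L hL => DiffPoly.isLenard_iff.mp hL⟩,
    ⟨_, DiffPoly.isModLenard_shift _, fun L hL => DiffPoly.isModLenard_iff.mp hL⟩, fun L hL => ?_⟩
  rw [DiffPoly.isLenard_iff.mp hL]
  refine ⟨fun hn1 Lh hLh => ?_, fun hn1 => ?_⟩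
  · have hΛ : ∀ σ k, modLenardOf Lh σ k
        = (DiffPoly.lenard k).evalAt fun x => deriv σ x - t (n - 1) / 2 := by
      intro σ k
      funext z
      rw [modLenardOf, DiffPoly.isModLenard_iff.mp hLh, DiffPoly.evalAt_shift]
    refine DiffPoly.sigmaEquivalence hUo hUc hn ht (fun z => (if_neg (by omega)).symm)
      (fun σ => DiffPoly.fSum_eq_flow (hΛ σ)) fun σ hσ z hz => ?_
    have hv : DifferentiableOn ℂ (fun x => deriv σ x - t (n - 1) / 2) U :=
      (hσ.deriv hUo).sub_const _
    have h1 : modLenardOf Lh σ 1 z = deriv σ z - t (n - 1) / 2 := by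
      rw [hΛ, DiffPoly.lenard_one, DiffPoly.evalAt_X, iteratedDeriv_zero]
    have hsum : ∑ l ∈ Finset.Icc 1 n, t l * (iteratedDeriv 2 (modLenardOf Lh σ l) z
          - modLenardOf Lh σ (l + 1) z)
        = (totalD (totalD (DiffPoly.flow n t))).evalAt (fun x => deriv σ x - t (n - 1) / 2) z
          - (DiffPoly.flowSucc n t).evalAt (fun x => deriv σ x - t (n - 1) / 2) z := by
      rw [DiffPoly.evalAt_totalD_totalD_flow, DiffPoly.evalAt_flowSucc, ← Finset.sum_sub_distrib]
      refine Finset.sum_congr rfl fun l _ => ?_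
      rw [hΛ, hΛ, DiffPoly.iteratedDeriv_two_evalAt hUo hv _ hz, mul_sub]
    rw [SigmaEq, hsum, h1, DiffPoly.fSum_eq_flow (hΛ σ),
      (DiffPoly.hasDerivAt_evalAt hUo hv _ hz).deriv, DiffPoly.gauge, if_neg (by omega),
      show 1 / 2 * t (n - 1) * z = t (n - 1) * z / 2 by ring]
  · subst hn1
    refine ⟨?_, fun σ hσ z hz => ⟨DiffPoly.sigmaEqOne_iff hUo hσ α hz,
      (DiffPoly.sigmaEqOne_iff hUo hσ α hz).trans (DiffPoly.okamotoSigmaEq_iff σ α z).symm⟩,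
      fun w hw z hz => DiffPoly.hamiltonian_one hUo hw ht α hz⟩
    have hsub : ∀ σ : ℂ → ℂ, (fun x => deriv σ x + x / 2) = fun x => deriv σ x - -x / 2 := by
      intro σ
      funext x
      ring
    have hΛ : ∀ σ k, modLenardOne DiffPoly.lenard σ k
        = (DiffPoly.lenard k).evalAt fun x => deriv σ x - -x / 2 := by
      intro σ k
      funext z
      rw [modLenardOne, hsub]
    refine DiffPoly.sigmaEquivalence hUo hUc le_rfl ht (fun z => (if_pos rfl).symm)
      (fun σ => by rw [DiffPoly.flow_one ht, hΛ]) fun σ hσ z hz => ?_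
    have hv : DifferentiableOn ℂ (fun x => deriv σ x - -x / 2) U :=
      (hσ.deriv hUo).sub (differentiableOn_id.neg.div_const 2)
    have h1 : (DiffPoly.lenard 1).evalAt (fun x => deriv σ x - -x / 2) z = deriv σ z - -z / 2 := by
      rw [DiffPoly.lenard_one, DiffPoly.evalAt_X, iteratedDeriv_zero]
    rw [SigmaEqOne, hΛ, hΛ, DiffPoly.flow_one ht, DiffPoly.flowSucc_one ht,
      DiffPoly.iteratedDeriv_two_evalAt hUo hv _ hz,
      (DiffPoly.hasDerivAt_evalAt hUo hv _ hz).deriv, DiffPoly.gauge, if_pos rfl, h1]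
    refine iff_of_eq (congrArg (· = α * (α - 1)) ?_)
    ring
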